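/- Let $\mathcal{E}$ be a category with finite limits. A morphism $f\colon B\to A$ of $\mathcal{E}$ is *exponentiable* if the pullback functor $\Delta_f\colon\mathcal{E}/A\to\mathcal{E}/B$ has a right adjoint $\Pi_f$. Let $\mathbf{Poly}_{\mathcal{E}}$ be the category whose objects (polynomials) are the exponentiable morphisms $p\colon P_*\to P$ of $\mathcal{E}$, and whose morphisms $\phi\colon p\to q$ consist of a morphism $\phi_1\colon P\to Q$ and a morphism $\phi^\sharp\colon P\times_Q Q_*\to P_*$ over $P$; the composite of $\phi\colon p\to q$ and $\psi\colon q\to r$ is $\psi_1\circ\phi_1$ on positions and $P\times_R R_*\cong P\times_Q(Q\times_R R_*)\to P\times_Q Q_*\to P_*$ on directions. Let $y$ be the polynomial $\mathrm{id}_1\colon 1\to 1$. For polynomials $p,q$ let $p\otimes q$ be the polynomial $p\times q\colon P_*\times Q_*\to P\times Q$, and let $p\mathbin{\triangleleft}q$ be the composite $$(\Pi_p(Q\times P_*)\times_P P_*)\times_Q Q_*\;\to\;\Pi_p(Q\times P_*)\times_P P_*\;\to\;\Pi_p(Q\times P_*),$$ where $Q\times P_*$ is regarded as an object over $P_*$ by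 projection and the map $\Pi_p(Q\times P_*)\times_P P_*\to Q$ used to form the outer pullback is the counit of $\Delta_p\dashv\Pi_p$ followed by projection. Both operations act on morphisms in the evident way (for $\otimes$: by $\phi_1\times\psi_1$ and $\phi^\sharp\times\psi^\sharp$). **Theorem.** The tensor product extends to a functor $\otimes\colon\mathbf{Poly}_{\mathcal{E}}\times\mathbf{Poly}_{\mathcal{E}}\to\mathbf{Poly}_{\mathcal{E}}$ such that, with the associator and unitors induced by those of the cartesian product of $\mathcal{E}$, $(\mathbf{Poly}_{\mathcal{E}},y,\otimes)$ is a monoidal category. Furthermore, $(\mathbf{Poly}_{\mathcal{E}},y,\otimes,y,\triangleleft)$ is a normal duoidal category: $(\mathbf{Poly}_{\mathcal{E}},y,\triangleleft)$, with its canonical associator and unitors, is also a monoidal category, and the canonical natural interchange morphisms $$(p\mathbin{\triangleleft}q)\otimes(r\mathbin{\triangleleft}s)\;\to\;(p\otimes r)\mathbin{\triangleleft}(q\otimes s),$$ (sending positions $((I,J),(K,L))$ to $(I,K,J\times L)$ and invertible on directions), together with the canonical morphisms $y\to y\mathbin{\triangleleft}y$, $y\otimes y\to y$ and $\mathrm{id}\colon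 y\to y$, satisfy the associativity, unitality and unit axioms of a duoidal category, the comparison $y\to y$ between the two units being an isomorphism. -/

import Mathlib

open CategoryTheory CategoryTheory.Limits

universe v u


/-- The data of a duoidal category: two monoidal structures `(⊗, I) = M` and `(◁, J) = N` on the same
category, the interchange morphisms `(A ◁ B) ⊗ (D ◁ F) ⟶ (A ⊗ D) ◁ (B ⊗ F)`, and the morphisms
`I ⟶ I ◁ I`, `J ⊗ J ⟶ J` and `I ⟶ J`. -/
structure DuoidalStruct (C : Type u) [Category.{v} C] where
  /-- the data of the first monoidal structure `(⊗, I)` -/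
  M : MonoidalCategoryStruct C
  /-- the data of the second monoidal structure `(◁, J)` -/
  N : MonoidalCategoryStruct C
  /-- the interchange -/
  interchange (A B D F : C) : M.tensorObj (N.tensorObj A B) (N.tensorObj D F) ⟶
    N.tensorObj (M.tensorObj A D) (M.tensorObj B F)
  /-- the morphism `I ⟶ I ◁ I` -/
  comult : M.tensorUnit ⟶ N.tensorObj M.tensorUnit M.tensorUnit
  /-- the morphism `J ⊗ J ⟶ J` -/
  mult : M.tensorObj N.tensorUnit N.tensorUnit ⟶ N.tensorUnit
  /-- the morphism `I ⟶ J` -/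
  unit : M.tensorUnit ⟶ N.tensorUnit

/-- The given data satisfy the axioms of a monoidal category. -/
def IsMonoidal {C : Type u} [Category.{v} C] (S : MonoidalCategoryStruct C) : Prop :=
  ∃ M : MonoidalCategory C, M.toMonoidalCategoryStruct = S

/-- The axioms of a duoidal category (also called a 2-monoidal category): both structures are
monoidal, the interchange is natural, and the structure morphisms satisfy the associativity,
unitality and unit axioms. Equivalently, `⊗` and `I` are colax monoidal functors for `(◁, J)`, and
the associator and unitors of `⊗` are monoidal transformations. -/
structure DuoidalStruct.IsDuoidal {C : Type u} [Category.{v} C] (S : DuoidalStruct C) : Prop where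
  monoidal_M : IsMonoidal S.M
  monoidal_N : IsMonoidal S.N
  interchange_natural {A A' B B' D D' F F' : C} (a : A ⟶ A') (b : B ⟶ B') (d : D ⟶ D')
    (f : F ⟶ F') :
    S.M.tensorHom (S.N.tensorHom a b) (S.N.tensorHom d f) ≫ S.interchange A' B' D' F' =
      S.interchange A B D F ≫ S.N.tensorHom (S.M.tensorHom a d) (S.M.tensorHom b f)
  /-- associativity with respect to `⊗` -/
  interchange_assoc_M (A B D F G H : C) :
    S.M.whiskerRight (S.interchange A B D F) (S.N.tensorObj G H) ≫
        S.interchange (S.M.tensorObj A D) (S.M.tensorObj B F) G H ≫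
        S.N.tensorHom (S.M.associator A D G).hom (S.M.associator B F H).hom =
      (S.M.associator (S.N.tensorObj A B) (S.N.tensorObj D F) (S.N.tensorObj G H)).hom ≫
        S.M.whiskerLeft (S.N.tensorObj A B) (S.interchange D F G H) ≫
        S.interchange A B (S.M.tensorObj D G) (S.M.tensorObj F H)
  /-- associativity with respect to `◁` -/
  interchange_assoc_N (A B D F G H : C) :
    S.interchange (S.N.tensorObj A B) D (S.N.tensorObj F G) H ≫
        S.N.whiskerRight (S.interchange A B F G) (S.M.tensorObj D H) ≫
        (S.N.associator (S.M.tensorObj A F) (S.M.tensorObj B G) (S.M.tensorObj D H)).hom =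
      S.M.tensorHom (S.N.associator A B D).hom (S.N.associator F G H).hom ≫
        S.interchange A (S.N.tensorObj B D) F (S.N.tensorObj G H) ≫
        S.N.whiskerLeft (S.M.tensorObj A F) (S.interchange B D G H)
  /-- left unitality with respect to `⊗` -/
  left_unit_M (A B : C) :
    S.M.whiskerRight S.comult (S.N.tensorObj A B) ≫
        S.interchange S.M.tensorUnit S.M.tensorUnit A B ≫
        S.N.tensorHom (S.M.leftUnitor A).hom (S.M.leftUnitor B).hom =
      (S.M.leftUnitor (S.N.tensorObj A B)).hom
  /-- right unitality with respect to `⊗` -/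
  right_unit_M (A B : C) :
    S.M.whiskerLeft (S.N.tensorObj A B) S.comult ≫
        S.interchange A B S.M.tensorUnit S.M.tensorUnit ≫
        S.N.tensorHom (S.M.rightUnitor A).hom (S.M.rightUnitor B).hom =
      (S.M.rightUnitor (S.N.tensorObj A B)).hom
  /-- left unitality with respect to `◁` -/
  left_unit_N (A B : C) :
    S.interchange S.N.tensorUnit A S.N.tensorUnit B ≫
        S.N.whiskerRight S.mult (S.M.tensorObj A B) ≫ (S.N.leftUnitor (S.M.tensorObj A B)).hom =
      S.M.tensorHom (S.N.leftUnitor A).hom (S.N.leftUnitor B).hom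
  /-- right unitality with respect to `◁` -/
  right_unit_N (A B : C) :
    S.interchange A S.N.tensorUnit B S.N.tensorUnit ≫
        S.N.whiskerLeft (S.M.tensorObj A B) S.mult ≫ (S.N.rightUnitor (S.M.tensorObj A B)).hom =
      S.M.tensorHom (S.N.rightUnitor A).hom (S.N.rightUnitor B).hom
  /-- `J` is a monoid for `⊗` -/
  unit_mult : S.M.whiskerRight S.unit S.N.tensorUnit ≫ S.mult = (S.M.leftUnitor S.N.tensorUnit).hom
  mult_unit : S.M.whiskerLeft S.N.tensorUnit S.unit ≫ S.mult = (S.M.rightUnitor S.N.tensorUnit).hom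
  mult_assoc : S.M.whiskerRight S.mult S.N.tensorUnit ≫ S.mult =
    (S.M.associator S.N.tensorUnit S.N.tensorUnit S.N.tensorUnit).hom ≫
      S.M.whiskerLeft S.N.tensorUnit S.mult ≫ S.mult
  /-- `I` is a comonoid for `◁` -/
  unit_comult : S.comult ≫ S.N.whiskerRight S.unit S.M.tensorUnit ≫
    (S.N.leftUnitor S.M.tensorUnit).hom = 𝟙 S.M.tensorUnit
  comult_unit : S.comult ≫ S.N.whiskerLeft S.M.tensorUnit S.unit ≫
    (S.N.rightUnitor S.M.tensorUnit).hom = 𝟙 S.M.tensorUnit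
  comult_assoc : S.comult ≫ S.N.whiskerRight S.comult S.M.tensorUnit ≫
      (S.N.associator S.M.tensorUnit S.M.tensorUnit S.M.tensorUnit).hom =
    S.comult ≫ S.N.whiskerLeft S.M.tensorUnit S.comult

/-- A duoidal category is normal if the morphism `I ⟶ J` between the units is invertible. -/
structure DuoidalStruct.IsNormalDuoidal {C : Type u} [Category.{v} C] (S : DuoidalStruct C) :
    Prop where
  isDuoidal : S.IsDuoidal
  isIso_unit : IsIso S.unit

/-- A morphism `f : B ⟶ A` is exponentiable if the pullback functor `Over A ⥤ Over B` has a right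
adjoint. -/
def Exponentiable {E : Type u} [Category.{v} E] [HasPullbacks E] {B A : E} (f : B ⟶ A) : Prop :=
  (Over.pullback f).IsLeftAdjoint

namespace Exponentiable

variable {E : Type u} [Category.{v} E] [HasPullbacks E]

theorem of_isIso {B A : E} (f : B ⟶ A) [IsIso f] : Exponentiable f := by
  have : (Over.pullback f).IsEquivalence :=
    (Over.mapPullbackAdj f).isEquivalence_right_of_isEquivalence_left
  unfold Exponentiable
  infer_instance

theorem comp {C B A : E} {g : C ⟶ B} {f : B ⟶ A} (hg : Exponentiable g) (hf : Exponentiable f) :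
    Exponentiable (g ≫ f) := by
  unfold Exponentiable at *
  exact Functor.isLeftAdjoint_of_iso (Over.pullbackComp g f).symm

theorem pullback_fst {B A C : E} {f : B ⟶ A} (hf : Exponentiable f) (g : C ⟶ A) :
    Exponentiable (pullback.fst g f) := by
  unfold Exponentiable at *
  let F : Over C ⥤ Over (pullback g f) :=
    (Over.iteratedSliceEquiv (Over.mk g)).inverse ⋙ Over.post (Over.pullback f) ⋙
      (Over.iteratedSliceEquiv ((Over.pullback f).obj (Over.mk g))).functor
  have : F.IsLeftAdjoint := inferInstance
  let e (X : Over C) : pullback (X.hom ≫ g) f ≅ pullback X.hom (pullback.fst g f) :=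
    { hom := pullback.lift (pullback.fst _ _)
        (pullback.lift (pullback.fst _ _ ≫ X.hom) (pullback.snd _ _)
          (by simpa using pullback.condition)) (by simp [pullback.lift_fst])
      inv := pullback.lift (pullback.fst _ _) (pullback.snd _ _ ≫ pullback.snd _ _)
        (by rw [pullback.condition_assoc, pullback.condition]; simp)
      hom_inv_id := by
        apply pullback.hom_ext <;> simp [pullback.lift_fst, pullback.lift_snd,
          pullback.lift_snd_assoc]
      inv_hom_id := by
        apply pullback.hom_ext
        · simp [pullback.lift_fst]
        · apply pullback.hom_ext <;> simp [pullback.lift_fst, pullback.lift_snd,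
            pullback.lift_fst_assoc, pullback.condition] }
  refine Functor.isLeftAdjoint_of_iso (F := F) (NatIso.ofComponents
    (fun X => Over.isoMk (e X) ?_) ?_)
  · change (e X).hom ≫ pullback.snd _ _ =
      pullback.lift (pullback.fst (X.hom ≫ g) f ≫ X.hom) (pullback.snd (X.hom ≫ g) f) _
    exact pullback.lift_snd _ _ _
  · intro X Y k
    ext
    change pullback.lift (pullback.fst (X.hom ≫ g) f ≫ k.left) (pullback.snd (X.hom ≫ g) f)
        (by simpa using pullback.condition) ≫ (e Y).hom =
      (e X).hom ≫ pullback.lift (pullback.fst X.hom (pullback.fst g f) ≫ k.left)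
        (pullback.snd X.hom (pullback.fst g f)) (by simpa using pullback.condition)
    apply pullback.hom_ext
    · simp [e, pullback.lift_fst, pullback.lift_fst_assoc]
    · apply pullback.hom_ext <;>
      simp [e, pullback.lift_fst, pullback.lift_snd, pullback.lift_fst_assoc,
        pullback.lift_snd_assoc]

theorem of_isPullback {B A C D : E} {f : B ⟶ A} (hf : Exponentiable f) {f' : D ⟶ C} {g : C ⟶ A}
    {g' : D ⟶ B} (h : IsPullback f' g' g f) : Exponentiable f' := by
  rw [← h.isoPullback_hom_fst]
  exact (of_isIso _).comp (hf.pullback_fst g)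

theorem prodMap [HasBinaryProducts E] {A B A' B' : E} {f : A ⟶ B} {g : A' ⟶ B'}
    (hf : Exponentiable f) (hg : Exponentiable g) : Exponentiable (prod.map f g) := by
  have h1 : IsPullback (prod.map f (𝟙 A')) prod.fst prod.fst f := by
    refine ⟨⟨by simp⟩, ⟨PullbackCone.IsLimit.mk _ (fun s => prod.lift s.snd (s.fst ≫ prod.snd))
      (fun s => ?_) (fun s => ?_) (fun s m h h' => ?_)⟩⟩
    · ext <;> simp [s.condition, prod.lift_fst, prod.lift_snd]
    · simp [prod.lift_fst, prod.lift_snd]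
    · ext <;> simp [← h, ← h', prod.lift_fst, prod.lift_snd]
  have h2 : IsPullback (prod.map (𝟙 B) g) prod.snd prod.snd g := by
    refine ⟨⟨by simp⟩, ⟨PullbackCone.IsLimit.mk _ (fun s => prod.lift (s.fst ≫ prod.fst) s.snd)
      (fun s => ?_) (fun s => ?_) (fun s m h h' => ?_)⟩⟩
    · ext <;> simp [s.condition, prod.lift_fst, prod.lift_snd]
    · simp [prod.lift_fst, prod.lift_snd]
    · ext <;> simp [← h, ← h', prod.lift_fst, prod.lift_snd]
  have := (hf.of_isPullback h1).comp (hg.of_isPullback h2)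
  simpa using this

end Exponentiable

/-- A polynomial in `E`: an exponentiable morphism `p : P_* ⟶ P`. -/
structure PolyCat (E : Type u) [Category.{v} E] [HasPullbacks E] where
  /-- the object `P` of positions -/
  base : E
  /-- the object `P_*` of directions -/
  total : E
  /-- the morphism `p` -/
  map : total ⟶ base
  exponentiable : Exponentiable map

namespace PolyCat

section Category

variable {E : Type u} [Category.{v} E] [HasPullbacks E]

/-- A morphism of polynomials `p ⟶ q`: a morphism `φ₁ : P ⟶ Q` together with a morphism
`φ♯ : P ×_Q Q_* ⟶ P_*` over `P`. The isomorphism class of such diagrams, over all choices of the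
pullback, has exactly one representative on the chosen pullback. -/
structure Hom (p q : PolyCat E) where
  /-- the component `φ₁` on positions -/
  pos : p.base ⟶ q.base
  /-- the component `φ♯` on directions -/
  dir : pullback pos q.map ⟶ p.total
  dir_map : dir ≫ p.map = pullback.fst pos q.map

/-- The action of `φ♯` on generalized elements: a position `b` of `p` and a direction `d` of `q` at
the position `φ₁ b` give a direction of `p` at `b`. -/
noncomputable def Hom.app {p q : PolyCat E} (φ : Hom p q) {Y : E} (b : Y ⟶ p.base)
    (d : Y ⟶ q.total) (h : b ≫ φ.pos = d ≫ q.map) : Y ⟶ p.total :=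
  pullback.lift b d h ≫ φ.dir

theorem Hom.app_map {p q : PolyCat E} (φ : Hom p q) {Y : E} (b : Y ⟶ p.base)
    (d : Y ⟶ q.total) (h : b ≫ φ.pos = d ≫ q.map) : φ.app b d h ≫ p.map = b := by
  rw [app, Category.assoc, φ.dir_map, pullback.lift_fst]

theorem Hom.comp_app {p q : PolyCat E} (φ : Hom p q) {Y Z : E} (y : Z ⟶ Y) (b : Y ⟶ p.base)
    (d : Y ⟶ q.total) (h : b ≫ φ.pos = d ≫ q.map) :
    y ≫ φ.app b d h = φ.app (y ≫ b) (y ≫ d) (by simp [h]) := by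
  rw [app, app, ← Category.assoc]
  congr 1
  apply pullback.hom_ext <;> simp [pullback.lift_fst, pullback.lift_snd]

theorem Hom.dir_eq_app {p q : PolyCat E} (φ : Hom p q) :
    φ.dir = φ.app (pullback.fst _ _) (pullback.snd _ _) pullback.condition := by
  rw [app, pullback.lift_fst_snd, Category.id_comp]

theorem Hom.app_mk {p q : PolyCat E} (f : p.base ⟶ q.base) (g : pullback f q.map ⟶ p.total)
    (w : g ≫ p.map = pullback.fst f q.map) {Y : E} (b : Y ⟶ p.base)
    (d : Y ⟶ q.total) (h : b ≫ f = d ≫ q.map) :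
    Hom.app ⟨f, g, w⟩ b d h = pullback.lift b d h ≫ g := rfl

theorem Hom.ext_app {p q : PolyCat E} {φ ψ : Hom p q} (h : φ.pos = ψ.pos)
    (h' : ∀ ⦃Y : E⦄ (b : Y ⟶ p.base) (d : Y ⟶ q.total) (hφ : b ≫ φ.pos = d ≫ q.map)
      (hψ : b ≫ ψ.pos = d ≫ q.map), φ.app b d hφ = ψ.app b d hψ) : φ = ψ := by
  obtain ⟨f, g, w⟩ := φ
  obtain ⟨f', g', w'⟩ := ψ
  obtain rfl : f = f' := h
  have := h' (pullback.fst _ _) (pullback.snd _ _) pullback.condition pullback.condition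
  rw [← Hom.dir_eq_app ⟨f, g, w⟩, ← Hom.dir_eq_app ⟨f, g', w'⟩] at this
  obtain rfl : g = g' := this
  rfl

/-- The identity morphism of a polynomial. -/
noncomputable def Hom.id (p : PolyCat E) : Hom p p where
  pos := 𝟙 p.base
  dir := pullback.snd (𝟙 p.base) p.map
  dir_map := by rw [← pullback.condition, Category.comp_id]

/-- The composite of morphisms of polynomials `φ : p ⟶ q` and `ψ : q ⟶ r`. On directions it is
`P ×_R R_* ≅ P ×_Q (Q ×_R R_*) ⟶ P ×_Q Q_* ⟶ P_*`. -/
noncomputable def Hom.comp {p q r : PolyCat E} (φ : Hom p q) (ψ : Hom q r) : Hom p r where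
  pos := φ.pos ≫ ψ.pos
  dir := φ.app (pullback.fst (φ.pos ≫ ψ.pos) r.map)
    (ψ.app (pullback.fst (φ.pos ≫ ψ.pos) r.map ≫ φ.pos) (pullback.snd (φ.pos ≫ ψ.pos) r.map)
      (by rw [Category.assoc, pullback.condition]))
    (by rw [Hom.app_map])
  dir_map := Hom.app_map _ _ _ _

noncomputable instance : CategoryStruct (PolyCat E) where
  Hom := Hom
  id := Hom.id
  comp := Hom.comp

@[simp]
theorem id_pos (p : PolyCat E) : Hom.pos (𝟙 p) = 𝟙 p.base := rfl

@[simp]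
theorem comp_pos {p q r : PolyCat E} (φ : p ⟶ q) (ψ : q ⟶ r) :
    Hom.pos (φ ≫ ψ) = Hom.pos φ ≫ Hom.pos ψ := rfl

theorem id_app (p : PolyCat E) {Y : E} (b : Y ⟶ p.base) (d : Y ⟶ p.total)
    (h : b ≫ Hom.pos (𝟙 p) = d ≫ p.map) : Hom.app (𝟙 p) b d h = d :=
  pullback.lift_snd _ _ _

theorem comp_app {p q r : PolyCat E} (φ : p ⟶ q) (ψ : q ⟶ r) {Y : E} (b : Y ⟶ p.base)
    (d : Y ⟶ r.total) (h : b ≫ Hom.pos (φ ≫ ψ) = d ≫ r.map) :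
    Hom.app (φ ≫ ψ) b d h =
      Hom.app φ b (Hom.app ψ (b ≫ Hom.pos φ) d (by simpa using h)) (by rw [Hom.app_map]) := by
  change pullback.lift b d h ≫ Hom.app φ _ _ _ = _
  refine (Hom.comp_app _ _ _ _ _).trans ?_
  congr 1
  · exact pullback.lift_fst _ _ _
  · refine (Hom.comp_app _ _ _ _ _).trans ?_
    congr 1
    · exact pullback.lift_fst_assoc _ _ _ _
    · exact pullback.lift_snd _ _ _

noncomputable instance : Category (PolyCat E) where
  id_comp φ := by
    refine Hom.ext_app (by simp) fun Y b d h h' => ?_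
    rw [comp_app, id_app]
    congr 1
    simp
  comp_id φ := by
    refine Hom.ext_app (by simp) fun Y b d h h' => ?_
    rw [comp_app]
    congr 1
    rw [id_app]
  assoc φ ψ χ := by
    refine Hom.ext_app (by simp) fun Y b d h h' => ?_
    simp only [comp_app]
    congr 2
    simp

/-- The invertible (cartesian) morphism of polynomials given by an isomorphism of arrows. -/
noncomputable def isoOfArrowIso {p q : PolyCat E} (e : p.base ≅ q.base) (e' : p.total ≅ q.total)
    (w : e'.hom ≫ q.map = p.map ≫ e.hom) : p ≅ q where
  hom :=
    { pos := e.hom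
      dir := pullback.snd e.hom q.map ≫ e'.inv
      dir_map := by
        rw [← cancel_mono e.hom]
        simp [← w, pullback.condition] }
  inv :=
    { pos := e.inv
      dir := pullback.snd e.inv p.map ≫ e'.hom
      dir_map := by
        rw [← cancel_mono e.inv]
        simp [w, pullback.condition] }
  hom_inv_id := by
    refine Hom.ext_app (by simp) fun Y b d h h' => ?_
    simp only [comp_app, id_app, Hom.app_mk]
    simp [pullback.lift_snd_assoc]
  inv_hom_id := by
    refine Hom.ext_app (by simp) fun Y b d h h' => ?_
    simp only [comp_app, id_app, Hom.app_mk]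
    simp [pullback.lift_snd_assoc]

end Category

section Monoidal

variable {E : Type u} [Category.{v} E] [HasFiniteLimits E]

/-- The identity polynomial `y`, the identity of the terminal object. -/
noncomputable abbrev y : PolyCat E where
  base := ⊤_ E
  total := ⊤_ E
  map := 𝟙 _
  exponentiable := .of_isIso _

/-! ### The Dirichlet tensor product -/

/-- The tensor product `P_* × Q_* ⟶ P × Q`. -/
noncomputable abbrev tensor (p q : PolyCat E) : PolyCat E where
  base := p.base ⨯ q.base
  total := p.total ⨯ q.total
  map := prod.map p.map q.map
  exponentiable := p.exponentiable.prodMap q.exponentiable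

/-- The tensor product of morphisms, `φ₁ × ψ₁` on positions and `φ♯ × ψ♯` on directions (along
`(P × Q) ×_{P' × Q'} (P'_* × Q'_*) ≅ (P ×_{P'} P'_*) × (Q ×_{Q'} Q'_*)`). -/
noncomputable def tensorMap {p p' q q' : PolyCat E} (φ : p ⟶ p') (ψ : q ⟶ q') :
    tensor p q ⟶ tensor p' q' where
  pos := prod.map φ.pos ψ.pos
  dir := prod.lift
    (φ.app (pullback.fst (prod.map φ.pos ψ.pos) (prod.map p'.map q'.map) ≫ prod.fst)
      (pullback.snd (prod.map φ.pos ψ.pos) (prod.map p'.map q'.map) ≫ prod.fst)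
      (by simpa using (pullback.condition (f := prod.map φ.pos ψ.pos)
        (g := prod.map p'.map q'.map)) =≫ prod.fst))
    (ψ.app (pullback.fst (prod.map φ.pos ψ.pos) (prod.map p'.map q'.map) ≫ prod.snd)
      (pullback.snd (prod.map φ.pos ψ.pos) (prod.map p'.map q'.map) ≫ prod.snd)
      (by simpa using (pullback.condition (f := prod.map φ.pos ψ.pos)
        (g := prod.map p'.map q'.map)) =≫ prod.snd))
  dir_map := by
    apply Limits.prod.hom_ext <;> simp [Hom.app_map, prod.lift_fst, prod.lift_snd]

/-- The associator of the tensor product, induced by the associativity of products. -/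
noncomputable def tensorAssoc (p q r : PolyCat E) :
    tensor (tensor p q) r ≅ tensor p (tensor q r) :=
  isoOfArrowIso (prod.associator p.base q.base r.base) (prod.associator p.total q.total r.total)
    (by simp)

/-- The left unitor of the tensor product, induced by `1 × A ≅ A`. -/
noncomputable def tensorLeftUnitor (p : PolyCat E) : tensor y p ≅ p :=
  isoOfArrowIso (prod.leftUnitor p.base) (prod.leftUnitor p.total)
    (prod.map_snd _ _).symm

/-- The right unitor of the tensor product, induced by `A × 1 ≅ A`. -/
noncomputable def tensorRightUnitor (p : PolyCat E) : tensor p y ≅ p :=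
  isoOfArrowIso (prod.rightUnitor p.base) (prod.rightUnitor p.total)
    (prod.map_fst _ _).symm

/-! ### The composition product -/

/-- The right adjoint `Π_p` of the pullback functor `Δ_p`. -/
noncomputable def push (p : PolyCat E) : Over p.total ⥤ Over p.base :=
  have : (Over.pullback p.map).IsLeftAdjoint := p.exponentiable
  (Over.pullback p.map).rightAdjoint

/-- The adjunction `Δ_p ⊣ Π_p`. -/
noncomputable def adj (p : PolyCat E) : Over.pullback p.map ⊣ p.push :=
  have : (Over.pullback p.map).IsLeftAdjoint := p.exponentiable
  Adjunction.ofIsLeftAdjoint (Over.pullback p.map)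

/-- The projection `Q × P_* ⟶ P_*` as an object over `P_*`. -/
noncomputable abbrev triOver (p q : PolyCat E) : Over p.total :=
  Over.mk (prod.snd : q.base ⨯ p.total ⟶ p.total)

/-- The object `Π_p (Q × P_*)` of positions of `p ◁ q`. -/
noncomputable def triBase (p q : PolyCat E) : E := (p.push.obj (triOver p q)).left

/-- The structure morphism `Π_p (Q × P_*) ⟶ P`. -/
noncomputable def triProj (p q : PolyCat E) : triBase p q ⟶ p.base := (p.push.obj (triOver p q)).hom

/-- The composite `Π_p (Q × P_*) ×_P P_* ⟶ Q × P_* ⟶ Q` of the counit of `Δ_p ⊣ Π_p` and the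
projection. -/
noncomputable def triEval (p q : PolyCat E) : pullback (triProj p q) p.map ⟶ q.base :=
  Over.Hom.left (p.adj.counit.app (triOver p q)) ≫ prod.fst

/-- `triEval` on generalized elements: a position `c` of `p ◁ q` and a direction `a` of `p` at the
position below `c` give a position of `q`. -/
noncomputable def eval {p q : PolyCat E} {Y : E} (c : Y ⟶ triBase p q) (a : Y ⟶ p.total)
    (h : c ≫ triProj p q = a ≫ p.map) : Y ⟶ q.base :=
  pullback.lift c a h ≫ triEval p q

theorem comp_eval {p q : PolyCat E} {Y Z : E} (y : Z ⟶ Y) (c : Y ⟶ triBase p q) (a : Y ⟶ p.total)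
    (h : c ≫ triProj p q = a ≫ p.map) :
    y ≫ eval c a h = eval (y ≫ c) (y ≫ a) (by simp [h]) := by
  rw [eval, eval, ← Category.assoc]
  congr 1
  apply pullback.hom_ext <;> simp [pullback.lift_fst, pullback.lift_snd]

theorem eval_congr {p q : PolyCat E} {Y : E} {c c' : Y ⟶ triBase p q} {a a' : Y ⟶ p.total}
    (hc : c = c') (ha : a = a') (h : c ≫ triProj p q = a ≫ p.map) :
    eval c a h = eval c' a' (by rw [← hc, h, ha]) := by
  subst hc ha
  rfl

/-- The universal property of `Π_p (Q × P_*)`: a morphism `b : Y ⟶ P` and a morphism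
`u : Y ×_P P_* ⟶ Q` determine a morphism `Y ⟶ Π_p (Q × P_*)`. -/
noncomputable def mkPos {p q : PolyCat E} {Y : E} (b : Y ⟶ p.base)
    (u : pullback b p.map ⟶ q.base) : Y ⟶ triBase p q :=
  Over.Hom.left (p.adj.homEquiv (Over.mk b) (triOver p q)
    (Over.homMk (prod.lift u (pullback.snd b p.map)) (prod.lift_snd _ _)))

@[simp]
theorem mkPos_proj {p q : PolyCat E} {Y : E} (b : Y ⟶ p.base) (u : pullback b p.map ⟶ q.base) :
    mkPos b u ≫ triProj p q = b :=
  Over.w (p.adj.homEquiv (Over.mk b) (triOver p q)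
    (Over.homMk (prod.lift u (pullback.snd b p.map)) (prod.lift_snd _ _)))

theorem eval_mkPos {p q : PolyCat E} {Y Z : E} (b : Y ⟶ p.base) (u : pullback b p.map ⟶ q.base)
    (x : Z ⟶ Y) (a : Z ⟶ p.total) (h : (x ≫ mkPos b u) ≫ triProj p q = a ≫ p.map) :
    eval (x ≫ mkPos b u) a h = pullback.lift x a (by simpa using h) ≫ u := by
  have key := (p.adj.homEquiv_counit (X := Over.mk b) (Y := triOver p q)
    (g := p.adj.homEquiv (Over.mk b) (triOver p q)
      (Over.homMk (prod.lift u (pullback.snd b p.map)) (prod.lift_snd _ _)))).symm.trans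
    (Equiv.symm_apply_apply _ _)
  have hu : pullback.lift (pullback.fst b p.map ≫ mkPos b u) (pullback.snd b p.map)
      (by rw [Category.assoc, mkPos_proj, pullback.condition]) ≫ triEval p q = u :=
    ((Category.assoc _ _ _).symm.trans (congrArg (fun k => Over.Hom.left k ≫ prod.fst) key)).trans
      (prod.lift_fst _ _)
  refine Eq.trans ?_ (congrArg (fun k => pullback.lift x a (by simpa using h) ≫ k) hu)
  rw [eval, ← Category.assoc]
  congr 1
  apply pullback.hom_ext <;>
    simp [pullback.lift_fst, pullback.lift_snd, pullback.lift_fst_assoc]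

/-- Two morphisms into `Π_p (Q × P_*)` are equal if they agree on generalized elements. -/
theorem pos_ext {p q : PolyCat E} {Y : E} {c c' : Y ⟶ triBase p q}
    (h : c ≫ triProj p q = c' ≫ triProj p q)
    (h' : ∀ ⦃Z : E⦄ (x : Z ⟶ Y) (a : Z ⟶ p.total) (hc : (x ≫ c) ≫ triProj p q = a ≫ p.map)
      (hc' : (x ≫ c') ≫ triProj p q = a ≫ p.map), eval (x ≫ c) a hc = eval (x ≫ c') a hc') :
    c = c' := by
  let b := c' ≫ triProj p q
  let k : Over.mk b ⟶ p.push.obj (triOver p q) := Over.homMk c h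
  let k' : Over.mk b ⟶ p.push.obj (triOver p q) := Over.homMk c' rfl
  suffices hk : k = k' from congrArg (fun k => Over.Hom.left k) hk
  apply (p.adj.homEquiv _ _).symm.injective
  rw [Adjunction.homEquiv_counit, Adjunction.homEquiv_counit]
  apply Over.OverMorphism.ext
  apply Limits.prod.hom_ext
  · have key := h' (pullback.fst b p.map) (pullback.snd b p.map)
      (by rw [Category.assoc, h, ← pullback.condition]) 
      (by rw [Category.assoc, ← pullback.condition])
    exact (Category.assoc _ _ _).trans (key.trans (Category.assoc _ _ _).symm)
  · exact (Over.w ((Over.pullback p.map).map k ≫ p.adj.counit.app (triOver p q))).trans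
      (Over.w ((Over.pullback p.map).map k' ≫ p.adj.counit.app (triOver p q))).symm

/-- The object `(Π_p (Q × P_*) ×_P P_*) ×_Q Q_*` of directions of `p ◁ q`. -/
noncomputable def triTotal (p q : PolyCat E) : E := pullback (triEval p q) q.map

/-- The projection `(Π_p (Q × P_*) ×_P P_*) ×_Q Q_* ⟶ Π_p (Q × P_*) ×_P P_*`. -/
noncomputable def triTop (p q : PolyCat E) : triTotal p q ⟶ pullback (triProj p q) p.map :=
  pullback.fst (triEval p q) q.map

/-- The composite `(Π_p (Q × P_*) ×_P P_*) ×_Q Q_* ⟶ Π_p (Q × P_*) ×_P P_* ⟶ Π_p (Q × P_*)`. -/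
noncomputable def triHom (p q : PolyCat E) : triTotal p q ⟶ triBase p q :=
  triTop p q ≫ pullback.fst (triProj p q) p.map

/-- The composition product `p ◁ q`. -/
noncomputable abbrev tri (p q : PolyCat E) : PolyCat E where
  base := triBase p q
  total := triTotal p q
  map := triHom p q
  exponentiable :=
    (q.exponentiable.pullback_fst (triEval p q)).comp (p.exponentiable.pullback_fst (triProj p q))

/-- The projection of the directions of `p ◁ q` to those of `p`. -/
noncomputable def dirFst (p q : PolyCat E) : triTotal p q ⟶ p.total :=
  triTop p q ≫ pullback.snd (triProj p q) p.map

/-- The projection of the directions of `p ◁ q` to those of `q`. -/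
noncomputable def dirSnd (p q : PolyCat E) : triTotal p q ⟶ q.total :=
  pullback.snd (triEval p q) q.map

/-- A generalized element of the directions of `p ◁ q`: a position `c` of `p ◁ q`, a direction `a`
of `p` below it, and a direction `d` of `q` at the position selected by `c` and `a`. -/
noncomputable def mkDir {p q : PolyCat E} {Y : E} (c : Y ⟶ triBase p q) (a : Y ⟶ p.total)
    (h : c ≫ triProj p q = a ≫ p.map) (d : Y ⟶ q.total) (h' : eval c a h = d ≫ q.map) :
    Y ⟶ triTotal p q :=
  pullback.lift (pullback.lift c a h) d h'

section

variable {p q : PolyCat E} {Y : E}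

theorem triHom_proj (p q : PolyCat E) :
    triHom p q ≫ triProj p q = dirFst p q ≫ p.map := by
  rw [triHom, dirFst, Category.assoc, Category.assoc, pullback.condition]

theorem dir_proj (e : Y ⟶ triTotal p q) :
    (e ≫ triHom p q) ≫ triProj p q = (e ≫ dirFst p q) ≫ p.map := by
  rw [Category.assoc, triHom_proj, Category.assoc]

theorem dir_eval (e : Y ⟶ triTotal p q) :
    eval (e ≫ triHom p q) (e ≫ dirFst p q) (dir_proj e) = (e ≫ dirSnd p q) ≫ q.map := by
  have : pullback.lift (e ≫ triHom p q) (e ≫ dirFst p q) (dir_proj e) =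
      e ≫ triTop p q := by
    apply pullback.hom_ext <;> simp [pullback.lift_fst, pullback.lift_snd, triHom, dirFst]
  have h : triTop p q ≫ triEval p q = dirSnd p q ≫ q.map := pullback.condition
  rw [eval, this, Category.assoc, Category.assoc, h]

variable (c : Y ⟶ triBase p q) (a : Y ⟶ p.total)
    (h : c ≫ triProj p q = a ≫ p.map) (d : Y ⟶ q.total) (h' : eval c a h = d ≫ q.map)

@[simp]
theorem mkDir_hom : mkDir c a h d h' ≫ triHom p q = c :=
  (pullback.lift_fst_assoc _ _ _ _).trans (pullback.lift_fst _ _ _)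

@[simp]
theorem mkDir_fst : mkDir c a h d h' ≫ dirFst p q = a :=
  (pullback.lift_fst_assoc _ _ _ _).trans (pullback.lift_snd _ _ _)

@[simp]
theorem mkDir_snd : mkDir c a h d h' ≫ dirSnd p q = d :=
  pullback.lift_snd _ _ _

theorem dir_ext {e e' : Y ⟶ triTotal p q} (h₀ : e ≫ triHom p q = e' ≫ triHom p q)
    (h₁ : e ≫ dirFst p q = e' ≫ dirFst p q) (h₂ : e ≫ dirSnd p q = e' ≫ dirSnd p q) :
    e = e' := by
  refine pullback.hom_ext (?_ : e ≫ triTop p q = e' ≫ triTop p q) ?_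
  · apply pullback.hom_ext
    · simpa [triHom] using h₀
    · simpa [dirFst] using h₁
  · exact h₂

end

/-- The composition product of morphisms on positions: `(b, u)` is sent to `φ₁ b` together with the
composite of `φ♯`, `u` and `ψ₁`. -/
noncomputable def triMapPos {p p' q q' : PolyCat E} (φ : p ⟶ p') (ψ : q ⟶ q') :
    triBase p q ⟶ triBase p' q' :=
  mkPos (triProj p q ≫ φ.pos)
    (eval (pullback.fst (triProj p q ≫ φ.pos) p'.map)
      (φ.app (pullback.fst (triProj p q ≫ φ.pos) p'.map ≫ triProj p q)
        (pullback.snd (triProj p q ≫ φ.pos) p'.map)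
        (by rw [Category.assoc, pullback.condition]))
      (by rw [Hom.app_map]) ≫ ψ.pos)

@[simp]
theorem triMapPos_proj {p p' q q' : PolyCat E} (φ : p ⟶ p') (ψ : q ⟶ q') :
    triMapPos φ ψ ≫ triProj p' q' = triProj p q ≫ φ.pos :=
  mkPos_proj _ _

theorem eval_triMapPos {p p' q q' : PolyCat E} (φ : p ⟶ p') (ψ : q ⟶ q') {Y : E}
    (c : Y ⟶ triBase p q) (a : Y ⟶ p'.total)
    (h : (c ≫ triMapPos φ ψ) ≫ triProj p' q' = a ≫ p'.map) :
    eval (c ≫ triMapPos φ ψ) a h =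
      eval c (φ.app (c ≫ triProj p q) a (by simpa using h)) (by rw [Hom.app_map]) ≫ ψ.pos := by
  refine (eval_mkPos _ _ _ _ _).trans ?_
  rw [← Category.assoc, comp_eval]
  congr 2
  · rw [pullback.lift_fst]
  · rw [Hom.comp_app]
    congr 1
    · rw [pullback.lift_fst_assoc]
    · rw [pullback.lift_snd]

/-- The composition product of morphisms: `triMapPos` on positions, and on directions
`(a, d) ↦ (φ♯ a, ψ♯ d)`. -/
noncomputable def triMap {p p' q q' : PolyCat E} (φ : p ⟶ p') (ψ : q ⟶ q') :
    tri p q ⟶ tri p' q' where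
  pos := triMapPos φ ψ
  dir :=
    have w₁ := (pullback.condition (f := triMapPos φ ψ) (g := triHom p' q'))
    have w₂ : (pullback.fst (triMapPos φ ψ) (triHom p' q') ≫ triProj p q) ≫ φ.pos =
        (pullback.snd (triMapPos φ ψ) (triHom p' q') ≫ dirFst p' q') ≫ p'.map := by
      simpa [triHom_proj] using w₁ =≫ triProj p' q'
    mkDir (pullback.fst (triMapPos φ ψ) (triHom p' q'))
      (φ.app (pullback.fst (triMapPos φ ψ) (triHom p' q') ≫ triProj p q)
        (pullback.snd (triMapPos φ ψ) (triHom p' q') ≫ dirFst p' q') w₂)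
      (by rw [Hom.app_map])
      (ψ.app
        (eval (pullback.fst (triMapPos φ ψ) (triHom p' q'))
          (φ.app (pullback.fst (triMapPos φ ψ) (triHom p' q') ≫ triProj p q)
            (pullback.snd (triMapPos φ ψ) (triHom p' q') ≫ dirFst p' q') w₂)
          (by rw [Hom.app_map]))
        (pullback.snd (triMapPos φ ψ) (triHom p' q') ≫ dirSnd p' q')
        (by
          rw [← dir_eval]
          exact (eval_triMapPos φ ψ _ _ (by rw [w₁, dir_proj])).symm.trans
            (eval_congr w₁ rfl _)))
      (Hom.app_map _ _ _ _).symm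
  dir_map := mkDir_hom _ _ _ _ _

/-! #### Unitors -/

/-- The morphism `Π_1 (P × 1) ⟶ P` selecting the position of `p` at the only direction of `y`. -/
noncomputable def triLeftBase (p : PolyCat E) : triBase y p ⟶ p.base :=
  eval (p := y) (q := p) (𝟙 _) (terminal.from _) (terminal.hom_ext _ _)

theorem comp_triLeftBase (p : PolyCat E) {Y : E} (c : Y ⟶ triBase y p) (a : Y ⟶ ⊤_ E)
    (h : c ≫ triProj y p = a ≫ 𝟙 _) : c ≫ triLeftBase p = eval (p := y) (q := p) c a h :=
  (comp_eval _ _ _ _).trans (eval_congr (Category.comp_id _) (terminal.hom_ext _ _) _)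

/-- The inverse of `triLeftBase`. -/
noncomputable def triLeftBaseInv (p : PolyCat E) : p.base ⟶ triBase y p :=
  mkPos (p := y) (q := p) (terminal.from _) (pullback.fst _ _)

theorem eval_triLeftBaseInv (p : PolyCat E) {Y : E} (b : Y ⟶ p.base) (a : Y ⟶ ⊤_ E)
    (h : (b ≫ triLeftBaseInv p) ≫ triProj y p = a ≫ 𝟙 _) :
    eval (p := y) (q := p) (b ≫ triLeftBaseInv p) a h = b :=
  (eval_mkPos (p := y) (q := p) _ _ _ _ _).trans (pullback.lift_fst _ _ _)

theorem triLeft_comm (p : PolyCat E) :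
    dirSnd y p ≫ p.map = triHom y p ≫ triLeftBase p := by
  refine (congrArg (· ≫ p.map) (Category.id_comp (dirSnd y p))).symm.trans
    ((dir_eval (𝟙 (triTotal y p))).symm.trans ?_)
  rw [comp_triLeftBase p _ (𝟙 _ ≫ dirFst y p) (terminal.hom_ext _ _)]
  exact eval_congr (Category.id_comp _) rfl _

/-- The isomorphism `triLeftBase`. -/
noncomputable def triLeftBaseIso (p : PolyCat E) : triBase y p ≅ p.base where
  hom := triLeftBase p
  inv := triLeftBaseInv p
  hom_inv_id := by
    refine pos_ext (p := y) (q := p) (terminal.hom_ext _ _) fun Z x a hc hc' => ?_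
    refine (eval_congr (Category.assoc _ _ _).symm rfl hc).trans
      ((eval_triLeftBaseInv p _ a (terminal.hom_ext _ _)).trans ?_)
    exact (comp_triLeftBase p x a (terminal.hom_ext _ _)).trans
      (eval_congr (Category.comp_id _).symm rfl _)
  inv_hom_id := by
    rw [comp_triLeftBase p _ (terminal.from _) (terminal.hom_ext _ _)]
    exact (eval_congr (Category.id_comp _).symm rfl _).trans
      (eval_triLeftBaseInv p (𝟙 _) _ (terminal.hom_ext _ _))

/-- The isomorphism `(Π_1 (P × 1) ×_1 1) ×_P P_* ≅ P_*`. -/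
noncomputable def triLeftTotalIso (p : PolyCat E) : triTotal y p ≅ p.total where
  hom := dirSnd y p
  inv := mkDir (p := y) (q := p) (p.map ≫ triLeftBaseInv p) (terminal.from _)
    (terminal.hom_ext _ _) (𝟙 _) (by
      rw [Category.id_comp]
      exact eval_triLeftBaseInv p p.map _ (terminal.hom_ext _ _))
  hom_inv_id := by
    apply dir_ext
    · rw [Category.assoc, mkDir_hom, Category.id_comp, ← Category.assoc, triLeft_comm,
        Category.assoc]
      exact (congrArg (triHom y p ≫ ·) (triLeftBaseIso p).hom_inv_id).trans (Category.comp_id _)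
    · exact terminal.hom_ext _ _
    · rw [Category.assoc, mkDir_snd, Category.comp_id, Category.id_comp]
  inv_hom_id := mkDir_snd _ _ _ _ _

/-- The left unitor `y ◁ p ≅ p`. -/
noncomputable def triLeftUnitor (p : PolyCat E) : tri y p ≅ p :=
  isoOfArrowIso (triLeftBaseIso p) (triLeftTotalIso p) (triLeft_comm p)

/-- The inverse of the isomorphism `Π_p (1 × P_*) ⟶ P`. -/
noncomputable def triRightBaseInv (p : PolyCat E) : p.base ⟶ triBase p y :=
  mkPos (p := p) (q := y) (𝟙 _) (terminal.from _)

/-- The isomorphism `Π_p (1 × P_*) ≅ P`. -/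
noncomputable def triRightBaseIso (p : PolyCat E) : triBase p y ≅ p.base where
  hom := triProj p y
  inv := triRightBaseInv p
  hom_inv_id := by
    refine pos_ext ?_ fun Z x a hc hc' => terminal.hom_ext _ _
    rw [Category.assoc, triRightBaseInv, mkPos_proj, Category.comp_id, Category.id_comp]
  inv_hom_id := mkPos_proj _ _

/-- The isomorphism `(Π_p (1 × P_*) ×_P P_*) ×_1 1 ≅ P_*`. -/
noncomputable def triRightTotalIso (p : PolyCat E) : triTotal p y ≅ p.total where
  hom := dirFst p y
  inv := mkDir (p := p) (q := y) (p.map ≫ triRightBaseInv p) (𝟙 _)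
    (by rw [Category.assoc, triRightBaseInv, mkPos_proj, Category.comp_id, Category.id_comp])
    (terminal.from _) (terminal.hom_ext _ _)
  hom_inv_id := by
    apply dir_ext
    · rw [Category.assoc, mkDir_hom, Category.id_comp, ← Category.assoc, ← triHom_proj,
        Category.assoc]
      exact (congrArg (triHom p y ≫ ·) (triRightBaseIso p).hom_inv_id).trans (Category.comp_id _)
    · rw [Category.assoc, mkDir_fst, Category.comp_id, Category.id_comp]
    · exact terminal.hom_ext _ _
  inv_hom_id := mkDir_fst _ _ _ _ _

/-- The right unitor `p ◁ y ≅ p`. -/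
noncomputable def triRightUnitor (p : PolyCat E) : tri p y ≅ p :=
  isoOfArrowIso (triRightBaseIso p) (triRightTotalIso p) (triHom_proj p y).symm

/-! #### Associator -/

section Assoc

variable (p q r : PolyCat E)

/-- The position of `p` below a position of `(p ◁ q) ◁ r`. -/
noncomputable def assocP : triBase (tri p q) r ⟶ p.base :=
  triProj (tri p q) r ≫ triProj p q

/-- The position of `q` given by a position of `(p ◁ q) ◁ r` and a direction of `p`. -/
noncomputable def assocQ : pullback (assocP p q r) p.map ⟶ q.base :=
  eval (pullback.fst (assocP p q r) p.map ≫ triProj (tri p q) r)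
    (pullback.snd (assocP p q r) p.map)
    (by rw [← pullback.condition, assocP, Category.assoc])

variable {p q r}

theorem lift_assocQ {Y : E} (c : Y ⟶ triBase (tri p q) r) (a : Y ⟶ p.total)
    (h : c ≫ assocP p q r = a ≫ p.map) :
    pullback.lift c a h ≫ assocQ p q r =
      eval (c ≫ triProj (tri p q) r) a (by rw [Category.assoc]; exact h) :=
  (comp_eval _ _ _ _).trans
    (eval_congr (pullback.lift_fst_assoc _ _ _ _) (pullback.lift_snd _ _ _) _)

variable (p q r)

/-- The position of `r` given by a position of `(p ◁ q) ◁ r`, a direction of `p` and a direction of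
`q`. -/
noncomputable def assocR : pullback (assocQ p q r) q.map ⟶ r.base :=
  eval (p := tri p q) (q := r)
    (pullback.fst (assocQ p q r) q.map ≫ pullback.fst (assocP p q r) p.map)
    (mkDir
      ((pullback.fst (assocQ p q r) q.map ≫ pullback.fst (assocP p q r) p.map) ≫
        triProj (tri p q) r)
      (pullback.fst (assocQ p q r) q.map ≫ pullback.snd (assocP p q r) p.map)
      (by
        simpa only [Category.assoc, assocP] using
          pullback.fst (assocQ p q r) q.map ≫= pullback.condition (f := assocP p q r) (g := p.map))
      (pullback.snd (assocQ p q r) q.map)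
      (((comp_eval _ _ _ _).trans (eval_congr (Category.assoc _ _ _).symm rfl _)).symm.trans
        (pullback.condition (f := assocQ p q r) (g := q.map))))
    (mkDir_hom _ _ _ _ _).symm

variable {p q r}

theorem lift_assocR {Y : E} (c : Y ⟶ triBase (tri p q) r) (a : Y ⟶ p.total)
    (h : c ≫ assocP p q r = a ≫ p.map) (d : Y ⟶ q.total)
    (h' : pullback.lift c a h ≫ assocQ p q r = d ≫ q.map) :
    pullback.lift (pullback.lift c a h) d h' ≫ assocR p q r =
      eval (p := tri p q) c
        (mkDir (c ≫ triProj (tri p q) r) a (by rw [Category.assoc]; exact h) d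
          ((lift_assocQ c a h).symm.trans h'))
        (mkDir_hom _ _ _ _ _).symm := by
  refine (comp_eval _ _ _ _).trans (eval_congr ?_ ?_ _)
  · rw [pullback.lift_fst_assoc, pullback.lift_fst]
  · apply dir_ext <;>
      simp [pullback.lift_fst, pullback.lift_snd, pullback.lift_fst_assoc]

variable (p q r)

/-- The associator on positions. -/
noncomputable def assocPos : triBase (tri p q) r ⟶ triBase p (tri q r) :=
  mkPos (q := tri q r) (assocP p q r) (mkPos (assocQ p q r) (assocR p q r))

variable {p q r}

theorem assocPos_proj : assocPos p q r ≫ triProj p (tri q r) = assocP p q r := mkPos_proj _ _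

theorem eval_assocPos {Y : E} (c : Y ⟶ triBase (tri p q) r) (a : Y ⟶ p.total)
    (h : (c ≫ assocPos p q r) ≫ triProj p (tri q r) = a ≫ p.map) :
    eval (q := tri q r) (c ≫ assocPos p q r) a h =
      pullback.lift c a (by rw [← h, Category.assoc, assocPos_proj]) ≫
        mkPos (assocQ p q r) (assocR p q r) :=
  eval_mkPos _ _ _ _ _

theorem eval_assocPos_proj {Y : E} (c : Y ⟶ triBase (tri p q) r) (a : Y ⟶ p.total)
    (h : (c ≫ assocPos p q r) ≫ triProj p (tri q r) = a ≫ p.map) :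
    eval (q := tri q r) (c ≫ assocPos p q r) a h ≫ triProj q r =
      eval (c ≫ triProj (tri p q) r) a
        (by rw [← h, Category.assoc, Category.assoc, assocPos_proj, assocP]) := by
  rw [eval_assocPos, Category.assoc, mkPos_proj, lift_assocQ]

theorem eval_eval_assocPos {Y : E} (c : Y ⟶ triBase (tri p q) r) (a : Y ⟶ p.total)
    (h : (c ≫ assocPos p q r) ≫ triProj p (tri q r) = a ≫ p.map) (d : Y ⟶ q.total)
    (h' : eval (q := tri q r) (c ≫ assocPos p q r) a h ≫ triProj q r = d ≫ q.map) :
    eval (eval (q := tri q r) (c ≫ assocPos p q r) a h) d h' =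
      eval (p := tri p q) c
        (mkDir (c ≫ triProj (tri p q) r) a
          (by rw [← h, Category.assoc, Category.assoc, assocPos_proj, assocP]) d
          ((eval_assocPos_proj c a h).symm.trans h'))
        (mkDir_hom _ _ _ _ _).symm := by
  refine (eval_congr (eval_assocPos c a h) rfl _).trans ?_
  rw [eval_mkPos, lift_assocR]

variable (p q r)

/-- The position of `p ◁ q` below a position of `p ◁ (q ◁ r)`. -/
noncomputable def assocInvPQ : triBase p (tri q r) ⟶ triBase p q :=
  mkPos (triProj p (tri q r)) (triEval p (tri q r) ≫ triProj q r)

variable {p q r}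

theorem assocInvPQ_proj : assocInvPQ p q r ≫ triProj p q = triProj p (tri q r) := mkPos_proj _ _

theorem eval_assocInvPQ {Y : E} (c : Y ⟶ triBase p (tri q r)) (a : Y ⟶ p.total)
    (h : (c ≫ assocInvPQ p q r) ≫ triProj p q = a ≫ p.map) :
    eval (c ≫ assocInvPQ p q r) a h =
      eval (q := tri q r) c a (by rw [← h, Category.assoc, assocInvPQ_proj]) ≫ triProj q r := by
  exact (eval_mkPos _ _ _ _ _).trans (Category.assoc _ _ _).symm

variable (p q r)

/-- The position of `r` given by a position of `p ◁ (q ◁ r)` and a direction of `p ◁ q`. -/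
noncomputable def assocInvR : pullback (assocInvPQ p q r) (triHom p q) ⟶ r.base :=
  have w := pullback.condition (f := assocInvPQ p q r) (g := triHom p q)
  eval
    (eval (q := tri q r) (pullback.fst (assocInvPQ p q r) (triHom p q))
      (pullback.snd (assocInvPQ p q r) (triHom p q) ≫ dirFst p q)
      (by rw [← dir_proj, ← w, Category.assoc, assocInvPQ_proj]))
    (pullback.snd (assocInvPQ p q r) (triHom p q) ≫ dirSnd p q)
    (by
      rw [← dir_eval]
      exact (eval_assocInvPQ _ _ (by rw [w, dir_proj])).symm.trans (eval_congr w rfl _))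

/-- The inverse of the associator on positions. -/
noncomputable def assocPosInv : triBase p (tri q r) ⟶ triBase (tri p q) r :=
  mkPos (p := tri p q) (assocInvPQ p q r) (assocInvR p q r)

variable {p q r}

theorem assocPosInv_proj : assocPosInv p q r ≫ triProj (tri p q) r = assocInvPQ p q r :=
  mkPos_proj _ _

theorem eval_assocPosInv {Y : E} (c : Y ⟶ triBase p (tri q r)) (e : Y ⟶ triTotal p q)
    (h : (c ≫ assocPosInv p q r) ≫ triProj (tri p q) r = e ≫ triHom p q)
    (w₁ : c ≫ triProj p (tri q r) = (e ≫ dirFst p q) ≫ p.map)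
    (w₂ : eval (q := tri q r) c (e ≫ dirFst p q) w₁ ≫ triProj q r = (e ≫ dirSnd p q) ≫ q.map) :
    eval (p := tri p q) (c ≫ assocPosInv p q r) e h =
      eval (eval (q := tri q r) c (e ≫ dirFst p q) w₁) (e ≫ dirSnd p q) w₂ := by
  refine (eval_mkPos (p := tri p q) _ _ _ _ _).trans ((comp_eval _ _ _ _).trans (eval_congr ?_ ?_ _))
  · refine (comp_eval _ _ _ _).trans (eval_congr ?_ ?_ _)
    · exact pullback.lift_fst _ _ _
    · exact pullback.lift_snd_assoc _ _ _ _
  · exact pullback.lift_snd_assoc _ _ _ _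

variable (p q r)

theorem assocPos_invPQ : assocPos p q r ≫ assocInvPQ p q r = triProj (tri p q) r := by
  refine pos_ext ?_ fun Z x a hc hc' => ?_
  · rw [Category.assoc, assocInvPQ_proj, assocPos_proj, assocP]
  · refine (eval_congr (Category.assoc _ _ _).symm rfl _).trans
      ((eval_assocInvPQ _ _ (by rw [← hc]; simp only [Category.assoc])).trans ?_)
    exact eval_assocPos_proj _ _ _

variable {p q r}

theorem assocPosInv_assocPos_proj :
    assocPosInv p q r ≫ assocPos p q r ≫ triProj p (tri q r) = triProj p (tri q r) := by
  rw [assocPos_proj, assocP, ← Category.assoc, assocPosInv_proj, assocInvPQ_proj]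

theorem eval_eval_assocPosInv {Y : E} (c : Y ⟶ triBase p (tri q r)) (a : Y ⟶ p.total)
    (h : ((c ≫ assocPosInv p q r) ≫ assocPos p q r) ≫ triProj p (tri q r) = a ≫ p.map)
    (h₁ : c ≫ triProj p (tri q r) = a ≫ p.map) (d : Y ⟶ q.total)
    (h' : eval (q := tri q r) ((c ≫ assocPosInv p q r) ≫ assocPos p q r) a h ≫ triProj q r =
      d ≫ q.map)
    (h₂ : eval (q := tri q r) c a h₁ ≫ triProj q r = d ≫ q.map) :
    eval (eval (q := tri q r) ((c ≫ assocPosInv p q r) ≫ assocPos p q r) a h) d h' =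
      eval (eval (q := tri q r) c a h₁) d h₂ := by
  rw [eval_eval_assocPos]
  generalize_proofs _ k₁ k₂ k₃
  have ha := mkDir_fst ((c ≫ assocPosInv p q r) ≫ triProj (tri p q) r) a k₁ d k₂
  have hd := mkDir_snd ((c ≫ assocPosInv p q r) ≫ triProj (tri p q) r) a k₁ d k₂
  generalize mkDir ((c ≫ assocPosInv p q r) ≫ triProj (tri p q) r) a k₁ d k₂ = e at ha hd k₃ ⊢
  subst ha hd
  exact eval_assocPosInv c e k₃ h₁ h₂

theorem eval_assocPosInv_assocPos {Y : E} (c : Y ⟶ triBase p (tri q r)) (a : Y ⟶ p.total)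
    (h : ((c ≫ assocPosInv p q r) ≫ assocPos p q r) ≫ triProj p (tri q r) = a ≫ p.map)
    (h₁ : c ≫ triProj p (tri q r) = a ≫ p.map) :
    eval (q := tri q r) ((c ≫ assocPosInv p q r) ≫ assocPos p q r) a h =
      eval (q := tri q r) c a h₁ := by
  refine pos_ext ?_ fun W z d hd hd' => ?_
  · rw [eval_assocPos_proj]
    refine (eval_congr (c' := c ≫ assocInvPQ p q r) ?_ rfl _).trans (eval_assocInvPQ _ _ _)
    rw [Category.assoc, assocPosInv_proj]
  · have e₁ : z ≫ eval (q := tri q r) ((c ≫ assocPosInv p q r) ≫ assocPos p q r) a h =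
        eval (q := tri q r) (((z ≫ c) ≫ assocPosInv p q r) ≫ assocPos p q r) (z ≫ a)
          (by simpa only [Category.assoc] using z ≫= h) :=
      (comp_eval (q := tri q r) _ _ _ _).trans
        (eval_congr (q := tri q r) (by simp only [Category.assoc]) rfl _)
    have e₂ : z ≫ eval (q := tri q r) c a h₁ = eval (q := tri q r) (z ≫ c) (z ≫ a)
        (by simpa only [Category.assoc] using z ≫= h₁) := comp_eval (q := tri q r) _ _ _ _
    refine (eval_congr e₁ rfl _).trans (Eq.trans ?_ (eval_congr e₂ rfl hd').symm)
    exact eval_eval_assocPosInv _ _ _ _ _ _ _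

variable (p q r)

theorem assocPos_hom_inv_id : assocPos p q r ≫ assocPosInv p q r = 𝟙 _ := by
  refine pos_ext (p := tri p q) ?_ fun Z x e hc hc' => ?_
  · rw [Category.assoc, assocPosInv_proj, assocPos_invPQ, Category.id_comp]
  · rw [Category.comp_id] at hc'
    have w₁ : (x ≫ assocPos p q r) ≫ triProj p (tri q r) = (e ≫ dirFst p q) ≫ p.map := by
      rw [Category.assoc, assocPos_proj, assocP, ← Category.assoc, hc', dir_proj]
    have w₂ : eval (q := tri q r) (x ≫ assocPos p q r) (e ≫ dirFst p q) w₁ ≫ triProj q r =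
        (e ≫ dirSnd p q) ≫ q.map := by
      rw [eval_assocPos_proj, ← dir_eval]
      exact eval_congr hc' rfl _
    refine (eval_congr (p := tri p q) (Category.assoc _ _ _).symm rfl _).trans
      ((eval_assocPosInv _ e (by rw [← hc]; simp only [Category.assoc]) w₁ w₂).trans
        ((eval_eval_assocPos _ _ w₁ _ w₂).trans
          (eval_congr (p := tri p q) (Category.comp_id _).symm ?_ _)))
    apply dir_ext <;> simp [hc']

theorem assocPos_inv_hom_id : assocPosInv p q r ≫ assocPos p q r = 𝟙 _ := by
  refine pos_ext (q := tri q r) ?_ fun Z x a hc hc' => ?_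
  · rw [Category.assoc, assocPosInv_assocPos_proj, Category.id_comp]
  · exact (eval_congr (q := tri q r) (Category.assoc _ _ _).symm rfl _).trans
      ((eval_assocPosInv_assocPos x a (by rw [← hc]; simp only [Category.assoc])
        (by rw [← hc', Category.comp_id])).trans
          (eval_congr (q := tri q r) (Category.comp_id _).symm rfl _))

/-- The isomorphism between the positions of `(p ◁ q) ◁ r` and of `p ◁ (q ◁ r)`. -/
noncomputable def assocPosIso : triBase (tri p q) r ≅ triBase p (tri q r) where
  hom := assocPos p q r
  inv := assocPosInv p q r
  hom_inv_id := assocPos_hom_inv_id p q r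
  inv_hom_id := assocPos_inv_hom_id p q r

/-- The associator on directions, `((a, d), s) ↦ (a, (d, s))`. -/
noncomputable def assocDir : triTotal (tri p q) r ⟶ triTotal p (tri q r) :=
  have w₁ : (triHom (tri p q) r ≫ assocPos p q r) ≫ triProj p (tri q r) =
      (dirFst (tri p q) r ≫ dirFst p q) ≫ p.map := by
    rw [Category.assoc, assocPos_proj, assocP, ← Category.assoc, triHom_proj, dir_proj]
  have w₂ : eval (q := tri q r) (triHom (tri p q) r ≫ assocPos p q r)
      (dirFst (tri p q) r ≫ dirFst p q) w₁ ≫ triProj q r =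
      (dirFst (tri p q) r ≫ dirSnd p q) ≫ q.map := by
    rw [eval_assocPos_proj, ← dir_eval]
    exact eval_congr (triHom_proj (tri p q) r) rfl _
  mkDir (q := tri q r) (triHom (tri p q) r ≫ assocPos p q r)
    (dirFst (tri p q) r ≫ dirFst p q) w₁
    (mkDir
      (eval (q := tri q r) (triHom (tri p q) r ≫ assocPos p q r)
        (dirFst (tri p q) r ≫ dirFst p q) w₁)
      (dirFst (tri p q) r ≫ dirSnd p q) w₂ (dirSnd (tri p q) r)
      (by
        refine (eval_eval_assocPos _ _ _ _ w₂).trans ?_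
        refine Eq.trans ?_ ((dir_eval (𝟙 (triTotal (tri p q) r))).trans
          (congrArg (· ≫ r.map) (Category.id_comp _)))
        refine eval_congr (p := tri p q) (Category.id_comp _).symm ?_ _
        rw [Category.id_comp]
        apply dir_ext
        · rw [mkDir_hom]
          exact triHom_proj (tri p q) r
        · rw [mkDir_fst]
        · rw [mkDir_snd]))
    (mkDir_hom _ _ _ _ _).symm

/-- The inverse of the associator on directions, `(a, (d, s)) ↦ ((a, d), s)`. -/
noncomputable def assocDirInv : triTotal p (tri q r) ⟶ triTotal (tri p q) r :=
  have w₁ : (triHom p (tri q r) ≫ assocInvPQ p q r) ≫ triProj p q =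
      dirFst p (tri q r) ≫ p.map := by
    rw [Category.assoc, assocInvPQ_proj, triHom_proj]
  have w₂ : eval (q := tri q r) (triHom p (tri q r)) (dirFst p (tri q r)) (triHom_proj _ _) =
      dirSnd p (tri q r) ≫ triHom q r := by
    refine (eval_congr (q := tri q r) (Category.id_comp _).symm (Category.id_comp _).symm _).trans
      ((dir_eval (𝟙 (triTotal p (tri q r)))).trans
        (congrArg (· ≫ triHom q r) (Category.id_comp _)))
  have w₃ : eval (triHom p (tri q r) ≫ assocInvPQ p q r) (dirFst p (tri q r)) w₁ =
      (dirSnd p (tri q r) ≫ dirFst q r) ≫ q.map := by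
    rw [eval_assocInvPQ, w₂, dir_proj]
  mkDir (p := tri p q) (triHom p (tri q r) ≫ assocPosInv p q r)
    (mkDir (triHom p (tri q r) ≫ assocInvPQ p q r) (dirFst p (tri q r)) w₁
      (dirSnd p (tri q r) ≫ dirFst q r) w₃)
    (by rw [Category.assoc, assocPosInv_proj, mkDir_hom])
    (dirSnd p (tri q r) ≫ dirSnd q r)
    (by
      have w₄ : eval (q := tri q r) (triHom p (tri q r))
          (mkDir (triHom p (tri q r) ≫ assocInvPQ p q r) (dirFst p (tri q r)) w₁
            (dirSnd p (tri q r) ≫ dirFst q r) w₃ ≫ dirFst p q)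
          (by rw [mkDir_fst, triHom_proj]) = dirSnd p (tri q r) ≫ triHom q r :=
        (eval_congr (q := tri q r) rfl (mkDir_fst _ _ _ _ _) _).trans w₂
      refine (eval_assocPosInv _ _ _ (by rw [mkDir_fst, triHom_proj])
        (by rw [w₄, mkDir_snd, dir_proj])).trans ?_
      exact (eval_congr w₄ (mkDir_snd _ _ _ _ _) _).trans (dir_eval _))

theorem assocDir_hom : assocDir p q r ≫ triHom p (tri q r) =
    triHom (tri p q) r ≫ assocPos p q r := mkDir_hom _ _ _ _ _

theorem assocDirInv_hom : assocDirInv p q r ≫ triHom (tri p q) r =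
    triHom p (tri q r) ≫ assocPosInv p q r := mkDir_hom _ _ _ _ _

theorem assocDir_fst : assocDir p q r ≫ dirFst p (tri q r) = dirFst (tri p q) r ≫ dirFst p q :=
  mkDir_fst _ _ _ _ _

theorem assocDir_snd_fst : (assocDir p q r ≫ dirSnd p (tri q r)) ≫ dirFst q r =
    dirFst (tri p q) r ≫ dirSnd p q :=
  (congrArg (· ≫ dirFst q r) (mkDir_snd _ _ _ _ _)).trans (mkDir_fst _ _ _ _ _)

theorem assocDir_snd_snd : (assocDir p q r ≫ dirSnd p (tri q r)) ≫ dirSnd q r =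
    dirSnd (tri p q) r :=
  (congrArg (· ≫ dirSnd q r) (mkDir_snd _ _ _ _ _)).trans (mkDir_snd _ _ _ _ _)

theorem assocDirInv_fst_fst : (assocDirInv p q r ≫ dirFst (tri p q) r) ≫ dirFst p q =
    dirFst p (tri q r) :=
  (congrArg (· ≫ dirFst p q) (mkDir_fst (p := tri p q) _ _ _ _ _)).trans (mkDir_fst _ _ _ _ _)

theorem assocDirInv_fst_snd : (assocDirInv p q r ≫ dirFst (tri p q) r) ≫ dirSnd p q =
    dirSnd p (tri q r) ≫ dirFst q r :=
  (congrArg (· ≫ dirSnd p q) (mkDir_fst (p := tri p q) _ _ _ _ _)).trans (mkDir_snd _ _ _ _ _)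

theorem assocDirInv_snd : assocDirInv p q r ≫ dirSnd (tri p q) r =
    dirSnd p (tri q r) ≫ dirSnd q r :=
  mkDir_snd (p := tri p q) _ _ _ _ _

theorem assocDir_hom_inv_id : assocDir p q r ≫ assocDirInv p q r = 𝟙 _ := by
  have h : (assocDir p q r ≫ assocDirInv p q r) ≫ triHom (tri p q) r = triHom (tri p q) r := by
    rw [Category.assoc, assocDirInv_hom, ← Category.assoc, assocDir_hom, Category.assoc,
      assocPos_hom_inv_id, Category.comp_id]
  have k : dirFst (tri p q) r ≫ triHom p q = triHom (tri p q) r ≫ triProj (tri p q) r :=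
    (triHom_proj (tri p q) r).symm
  apply dir_ext (p := tri p q)
  · rw [h, Category.id_comp]
  · rw [Category.id_comp]
    apply dir_ext
    · rw [Category.assoc, k, ← Category.assoc, h]
    · have := assocDirInv_fst_fst p q r
      rw [Category.assoc] at this
      rw [Category.assoc, Category.assoc, this, assocDir_fst]
    · have := assocDirInv_fst_snd p q r
      rw [Category.assoc] at this
      rw [Category.assoc, Category.assoc, this, ← Category.assoc, assocDir_snd_fst]
  · rw [Category.assoc, assocDirInv_snd, ← Category.assoc, assocDir_snd_snd, Category.id_comp]

theorem assocDir_inv_hom_id : assocDirInv p q r ≫ assocDir p q r = 𝟙 _ := by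
  have h : (assocDirInv p q r ≫ assocDir p q r) ≫ triHom p (tri q r) = triHom p (tri q r) := by
    rw [Category.assoc, assocDir_hom, ← Category.assoc, assocDirInv_hom, Category.assoc,
      assocPos_inv_hom_id, Category.comp_id]
  have h₁ : (assocDirInv p q r ≫ assocDir p q r) ≫ dirFst p (tri q r) = dirFst p (tri q r) := by
    rw [Category.assoc, assocDir_fst, ← Category.assoc, assocDirInv_fst_fst]
  apply dir_ext (q := tri q r)
  · rw [h, Category.id_comp]
  · rw [h₁, Category.id_comp]
  · rw [Category.id_comp]
    apply dir_ext
    · have e₁ := dir_eval (q := tri q r) (assocDirInv p q r ≫ assocDir p q r)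
      have e₂ := dir_eval (q := tri q r) (𝟙 (triTotal p (tri q r)))
      rw [Category.id_comp (dirSnd p (tri q r))] at e₂
      exact e₁.symm.trans ((eval_congr (q := tri q r) (h.trans (Category.id_comp _).symm)
        (h₁.trans (Category.id_comp _).symm) _).trans e₂)
    · have := assocDir_snd_fst p q r
      rw [Category.assoc] at this
      rw [Category.assoc, Category.assoc, this, ← Category.assoc, assocDirInv_fst_snd]
    · have := assocDir_snd_snd p q r
      rw [Category.assoc] at this
      rw [Category.assoc, Category.assoc, this, assocDirInv_snd]

/-- The isomorphism between the directions of `(p ◁ q) ◁ r` and of `p ◁ (q ◁ r)`. -/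
noncomputable def assocDirIso : triTotal (tri p q) r ≅ triTotal p (tri q r) where
  hom := assocDir p q r
  inv := assocDirInv p q r
  hom_inv_id := assocDir_hom_inv_id p q r
  inv_hom_id := assocDir_inv_hom_id p q r

/-- The associator `(p ◁ q) ◁ r ≅ p ◁ (q ◁ r)`. -/
noncomputable def triAssoc : tri (tri p q) r ≅ tri p (tri q r) :=
  isoOfArrowIso (assocPosIso p q r) (assocDirIso p q r) (assocDir_hom p q r)

end Assoc

/-! ### The interchange -/

section Interchange

variable (p q r s : PolyCat E)

/-- The interchange on positions, `Π_p (Q × P_*) × Π_r (S × R_*) ⟶ Π_{p ⊗ r} ((Q × S) × (P_* × R_*))`: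
`((I, J), (K, L)) ↦ (I, K, J × L)`. -/
noncomputable def interchangePos :
    triBase p q ⨯ triBase r s ⟶ triBase (tensor p r) (tensor q s) :=
  have w := pullback.condition (f := prod.map (triProj p q) (triProj r s))
    (g := prod.map p.map r.map)
  mkPos (p := tensor p r) (q := tensor q s) (prod.map (triProj p q) (triProj r s))
    (prod.lift
      (eval
        (pullback.fst (prod.map (triProj p q) (triProj r s)) (prod.map p.map r.map) ≫ prod.fst)
        (pullback.snd (prod.map (triProj p q) (triProj r s)) (prod.map p.map r.map) ≫ prod.fst)
        (by simpa using w =≫ prod.fst))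
      (eval
        (pullback.fst (prod.map (triProj p q) (triProj r s)) (prod.map p.map r.map) ≫ prod.snd)
        (pullback.snd (prod.map (triProj p q) (triProj r s)) (prod.map p.map r.map) ≫ prod.snd)
        (by simpa using w =≫ prod.snd)))

variable {p q r s}

theorem interchangePos_proj : interchangePos p q r s ≫ triProj (tensor p r) (tensor q s) =
    prod.map (triProj p q) (triProj r s) := mkPos_proj _ _

theorem eval_interchangePos {Y : E} (c : Y ⟶ triBase p q ⨯ triBase r s)
    (a : Y ⟶ p.total ⨯ r.total)
    (h : (c ≫ interchangePos p q r s) ≫ triProj (tensor p r) (tensor q s) =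
      a ≫ prod.map p.map r.map)
    (h₁ : (c ≫ prod.fst) ≫ triProj p q = (a ≫ prod.fst) ≫ p.map)
    (h₂ : (c ≫ prod.snd) ≫ triProj r s = (a ≫ prod.snd) ≫ r.map) :
    eval (p := tensor p r) (q := tensor q s) (c ≫ interchangePos p q r s) a h =
      prod.lift (eval (c ≫ prod.fst) (a ≫ prod.fst) h₁)
        (eval (c ≫ prod.snd) (a ≫ prod.snd) h₂) := by
  refine (eval_mkPos (p := tensor p r) (q := tensor q s) _ _ _ _ _).trans ?_
  apply Limits.prod.hom_ext
  · rw [Category.assoc, prod.lift_fst, prod.lift_fst]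
    exact (comp_eval _ _ _ _).trans (eval_congr (pullback.lift_fst_assoc _ _ _ _)
      (pullback.lift_snd_assoc _ _ _ _) _)
  · rw [Category.assoc, prod.lift_snd, prod.lift_snd]
    exact (comp_eval _ _ _ _).trans (eval_congr (pullback.lift_fst_assoc _ _ _ _)
      (pullback.lift_snd_assoc _ _ _ _) _)

variable (p q r s)

/-- The interchange `(p ◁ q) ⊗ (r ◁ s) ⟶ (p ⊗ r) ◁ (q ⊗ s)`: `interchangePos` on positions, and the
isomorphism `((a, a'), (d, d')) ↦ ((a, d), (a', d'))` on directions. -/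
noncomputable def interchange :
    tensor (tri p q) (tri r s) ⟶ tri (tensor p r) (tensor q s) where
  pos := interchangePos p q r s
  dir :=
    have w := pullback.condition (f := interchangePos p q r s)
      (g := triHom (tensor p r) (tensor q s))
    have k : (pullback.fst (interchangePos p q r s) (triHom (tensor p r) (tensor q s)) ≫
        interchangePos p q r s) ≫ triProj (tensor p r) (tensor q s) =
        (pullback.snd (interchangePos p q r s) (triHom (tensor p r) (tensor q s)) ≫
          dirFst (tensor p r) (tensor q s)) ≫ prod.map p.map r.map := by
      rw [w, dir_proj]
    have k₁ : (pullback.fst (interchangePos p q r s) (triHom (tensor p r) (tensor q s)) ≫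
        prod.fst) ≫ triProj p q =
        ((pullback.snd (interchangePos p q r s) (triHom (tensor p r) (tensor q s)) ≫
          dirFst (tensor p r) (tensor q s)) ≫ prod.fst) ≫ p.map := by
      have := k =≫ prod.fst
      rw [Category.assoc _ _ (triProj (tensor p r) (tensor q s)), interchangePos_proj] at this
      simpa using this
    have k₂ : (pullback.fst (interchangePos p q r s) (triHom (tensor p r) (tensor q s)) ≫
        prod.snd) ≫ triProj r s =
        ((pullback.snd (interchangePos p q r s) (triHom (tensor p r) (tensor q s)) ≫
          dirFst (tensor p r) (tensor q s)) ≫ prod.snd) ≫ r.map := by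
      have := k =≫ prod.snd
      rw [Category.assoc _ _ (triProj (tensor p r) (tensor q s)), interchangePos_proj] at this
      simpa using this
    have e := (eval_interchangePos _ _ k k₁ k₂).symm.trans
      ((eval_congr (p := tensor p r) (q := tensor q s) w rfl _).trans (dir_eval _))
    prod.lift
      (mkDir
        (pullback.fst (interchangePos p q r s) (triHom (tensor p r) (tensor q s)) ≫ prod.fst)
        ((pullback.snd (interchangePos p q r s) (triHom (tensor p r) (tensor q s)) ≫
          dirFst (tensor p r) (tensor q s)) ≫ prod.fst) k₁
        ((pullback.snd (interchangePos p q r s) (triHom (tensor p r) (tensor q s)) ≫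
          dirSnd (tensor p r) (tensor q s)) ≫ prod.fst)
        (by simpa [prod.lift_fst] using e =≫ prod.fst))
      (mkDir
        (pullback.fst (interchangePos p q r s) (triHom (tensor p r) (tensor q s)) ≫ prod.snd)
        ((pullback.snd (interchangePos p q r s) (triHom (tensor p r) (tensor q s)) ≫
          dirFst (tensor p r) (tensor q s)) ≫ prod.snd) k₂
        ((pullback.snd (interchangePos p q r s) (triHom (tensor p r) (tensor q s)) ≫
          dirSnd (tensor p r) (tensor q s)) ≫ prod.snd)
        (by simpa [prod.lift_snd] using e =≫ prod.snd))
  dir_map := by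
    refine (prod.lift_map _ _ _ _).trans ?_
    rw [mkDir_hom, mkDir_hom]
    apply Limits.prod.hom_ext
    · rw [prod.lift_fst]
    · rw [prod.lift_snd]

end Interchange

variable (E)

/-- The data of the monoidal category `(Poly_E, y, ⊗)`. -/
noncomputable abbrev tensorStruct : MonoidalCategoryStruct (PolyCat E) where
  tensorObj := tensor
  tensorUnit := y
  tensorHom := tensorMap
  whiskerLeft p _ _ φ := tensorMap (𝟙 p) φ
  whiskerRight φ q := tensorMap φ (𝟙 q)
  associator := tensorAssoc
  leftUnitor := tensorLeftUnitor
  rightUnitor := tensorRightUnitor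

/-- The data of the monoidal category `(Poly_E, y, ◁)`. -/
noncomputable abbrev triStruct : MonoidalCategoryStruct (PolyCat E) where
  tensorObj := tri
  tensorUnit := y
  tensorHom := triMap
  whiskerLeft p _ _ φ := triMap (𝟙 p) φ
  whiskerRight φ q := triMap φ (𝟙 q)
  associator := triAssoc
  leftUnitor := triLeftUnitor
  rightUnitor := triRightUnitor

/-- The data of the duoidal category `(Poly_E, y, ⊗, y, ◁)`. -/
noncomputable abbrev duoidalStruct : DuoidalStruct (PolyCat E) where
  M := tensorStruct E
  N := triStruct E
  interchange := interchange
  comult := (triLeftUnitor y).inv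
  mult := (tensorLeftUnitor y).hom
  unit := 𝟙 y

end Monoidal

end PolyCat

/-!
A morphism `φ : p ⟶ q` is determined by what it does to generalized elements: it sends a position
`b : Y ⟶ p.base` to `b ≫ φ.pos`, and a direction `d : Y ⟶ q.total` at `b ≫ φ.pos` to a direction
`φ.app b d` of `p` at `b`. A position `c` of `p ◁ q` is in turn determined by the position
`c ≫ triProj p q` of `p` together with the positions `eval c a` of `q`, for `a` a direction of `p`
there, and a direction of `p ◁ q` at `c` is a pair consisting of such an `a` and a direction of `q`
at `eval c a`. In these terms all structure morphisms of `⊗` and `◁` and the interchange are given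
by the formulas they have for sets, and a coherence axiom becomes an identity between two such
formulas, which holds by substitution.

The axioms relating the two units need no computation: the structure map of `y` is the identity of
the terminal object, and a morphism `p ⟶ y` is unique as soon as `p.map` is a monomorphism.
-/

namespace PolyCat

section

variable {C : Type u} [Category.{v} C] {X A B : C} [HasBinaryProduct A B]

theorem comp_prodMap {A' B' : C} [HasBinaryProduct A' B'] (x : X ⟶ A ⨯ B) (f : A ⟶ A')
    (g : B ⟶ B') :
    x ≫ prod.map f g = prod.lift ((x ≫ prod.fst) ≫ f) ((x ≫ prod.snd) ≫ g) := by
  ext <;> simp [prod.lift_fst, prod.lift_snd]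

theorem prodLift_comp_fst_comp_snd (x : X ⟶ A ⨯ B) :
    prod.lift (x ≫ prod.fst) (x ≫ prod.snd) = x := by
  ext <;> simp [prod.lift_fst, prod.lift_snd]

end

theorem comp_prodAssociator_inv {C : Type u} [Category.{v} C] [HasBinaryProducts C] {Y A B D : C}
    (x : Y ⟶ A ⨯ B ⨯ D) :
    x ≫ (prod.associator A B D).inv = prod.lift
      (prod.lift (x ≫ prod.fst) ((x ≫ prod.snd) ≫ prod.fst)) ((x ≫ prod.snd) ≫ prod.snd) := by
  simp [prod.comp_lift]

section

variable {E : Type u} [Category.{v} E] [HasPullbacks E] {p q : PolyCat E} {Y : E}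

theorem Hom.ext_of_mono [Mono p.map] {φ ψ : p ⟶ q} (h : Hom.pos φ = Hom.pos ψ) : φ = ψ :=
  Hom.ext_app h fun _ _ _ _ _ => by
    rw [← cancel_mono p.map, Hom.app_map, Hom.app_map]

theorem hom_ext_elements {φ ψ : p ⟶ q}
    (hpos : ∀ ⦃Y : E⦄ (b : Y ⟶ p.base), b ≫ Hom.pos φ = b ≫ Hom.pos ψ)
    (happ : ∀ ⦃Y : E⦄ (b : Y ⟶ p.base) (d : Y ⟶ q.total) (hφ : b ≫ Hom.pos φ = d ≫ q.map)
      (hψ : b ≫ Hom.pos ψ = d ≫ q.map), Hom.app φ b d hφ = Hom.app ψ b d hψ) : φ = ψ :=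
  Hom.ext_app (by simpa using hpos (𝟙 _)) happ

theorem isoOfArrowIso_hom_app (e : p.base ≅ q.base) (e' : p.total ≅ q.total)
    (w : e'.hom ≫ q.map = p.map ≫ e.hom) (b : Y ⟶ p.base) (d : Y ⟶ q.total)
    (h : b ≫ Hom.pos (isoOfArrowIso e e' w).hom = d ≫ q.map) :
    Hom.app (isoOfArrowIso e e' w).hom b d h = d ≫ e'.inv :=
  pullback.lift_snd_assoc _ _ _ _

end

section

variable {E : Type u} [Category.{v} E] [HasFiniteLimits E] {p p' q q' r r' s s' t w : PolyCat E}
  {Y : E}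

theorem tensorMap_pos (φ : p ⟶ p') (ψ : q ⟶ q') :
    Hom.pos (tensorMap φ ψ) = prod.map (Hom.pos φ) (Hom.pos ψ) := rfl

theorem tensorMap_app (φ : p ⟶ p') (ψ : q ⟶ q') (b : Y ⟶ p.base ⨯ q.base)
    (d : Y ⟶ p'.total ⨯ q'.total)
    (h : b ≫ Hom.pos (tensorMap φ ψ) = d ≫ prod.map p'.map q'.map) :
    Hom.app (tensorMap φ ψ) b d h = prod.lift
      (Hom.app φ (b ≫ prod.fst) (d ≫ prod.fst)
        (by simpa [tensorMap_pos] using h =≫ prod.fst))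
      (Hom.app ψ (b ≫ prod.snd) (d ≫ prod.snd)
        (by simpa [tensorMap_pos] using h =≫ prod.snd)) := by
  simp [tensorMap, Hom.app_mk, prod.comp_lift, Hom.comp_app, pullback.lift_fst_assoc,
    pullback.lift_snd_assoc]

theorem comp_mkDir {Z : E} (x : Z ⟶ Y) (c : Y ⟶ triBase p q) (a : Y ⟶ p.total)
    (h : c ≫ triProj p q = a ≫ p.map) (d : Y ⟶ q.total) (h' : eval c a h = d ≫ q.map) :
    x ≫ mkDir c a h d h' = mkDir (x ≫ c) (x ≫ a) (by simp only [Category.assoc, h]) (x ≫ d)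
      (by rw [← comp_eval _ _ _ h, h', Category.assoc]) := by
  apply dir_ext <;> simp

theorem comp_triMap_pos_proj (φ : p ⟶ p') (ψ : q ⟶ q') (c : Y ⟶ triBase p q) :
    (c ≫ Hom.pos (triMap φ ψ)) ≫ triProj p' q' = (c ≫ triProj p q) ≫ Hom.pos φ := by
  simp [triMap]

theorem eval_comp_triMap_pos (φ : p ⟶ p') (ψ : q ⟶ q') (c : Y ⟶ triBase p q) (a : Y ⟶ p'.total)
    (h : (c ≫ Hom.pos (triMap φ ψ)) ≫ triProj p' q' = a ≫ p'.map) :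
    eval (c ≫ Hom.pos (triMap φ ψ)) a h =
      eval c (Hom.app φ (c ≫ triProj p q) a (by rw [← comp_triMap_pos_proj, h]))
        (by rw [Hom.app_map]) ≫ Hom.pos ψ := eval_triMapPos φ ψ c a h

theorem triMap_app (φ : p ⟶ p') (ψ : q ⟶ q') (c : Y ⟶ triBase p q) (e : Y ⟶ triTotal p' q')
    (h : c ≫ Hom.pos (triMap φ ψ) = e ≫ triHom p' q') :
    Hom.app (triMap φ ψ) c e h = mkDir c
      (Hom.app φ (c ≫ triProj p q) (e ≫ dirFst p' q')
        (by rw [← comp_triMap_pos_proj, h, dir_proj]))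
      (by rw [Hom.app_map])
      (Hom.app ψ
        (eval c (Hom.app φ (c ≫ triProj p q) (e ≫ dirFst p' q')
          (by rw [← comp_triMap_pos_proj, h, dir_proj])) (by rw [Hom.app_map]))
        (e ≫ dirSnd p' q')
        (by
          rw [← dir_eval]
          exact (eval_comp_triMap_pos φ ψ _ _ (by rw [h, dir_proj])).symm.trans
            (eval_congr h rfl _)))
      (Hom.app_map _ _ _ _).symm := by
  simp [triMap, Hom.app_mk, comp_mkDir, comp_eval, Hom.comp_app, pullback.lift_fst,
    pullback.lift_fst_assoc, pullback.lift_snd_assoc]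

theorem comp_interchange_pos_proj (c : Y ⟶ triBase p q ⨯ triBase r s) :
    (c ≫ Hom.pos (interchange p q r s)) ≫ triProj (tensor p r) (tensor q s) =
      prod.lift ((c ≫ prod.fst) ≫ triProj p q) ((c ≫ prod.snd) ≫ triProj r s) := by
  rw [← comp_prodMap, Category.assoc]
  exact congrArg (c ≫ ·) interchangePos_proj

theorem eval_comp_interchange_pos (c : Y ⟶ triBase p q ⨯ triBase r s)
    (a : Y ⟶ p.total ⨯ r.total)
    (h : (c ≫ Hom.pos (interchange p q r s)) ≫ triProj (tensor p r) (tensor q s) =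
      a ≫ prod.map p.map r.map) :
    eval (p := tensor p r) (q := tensor q s) (c ≫ Hom.pos (interchange p q r s)) a h =
      prod.lift
        (eval (c ≫ prod.fst) (a ≫ prod.fst)
          (by simpa [prod.lift_fst] using (comp_interchange_pos_proj c).symm.trans h =≫ prod.fst))
        (eval (c ≫ prod.snd) (a ≫ prod.snd)
          (by
            simpa [prod.lift_snd] using (comp_interchange_pos_proj c).symm.trans h =≫ prod.snd)) :=
  eval_interchangePos c a h _ _

section

variable {c : Y ⟶ triBase p q ⨯ triBase r s} {e : Y ⟶ triTotal (tensor p r) (tensor q s)}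

theorem interchange_dir_proj
    (h : c ≫ Hom.pos (interchange p q r s) = e ≫ triHom (tensor p r) (tensor q s)) :
    (c ≫ prod.fst) ≫ triProj p q = ((e ≫ dirFst (tensor p r) (tensor q s)) ≫ prod.fst) ≫ p.map ∧
      (c ≫ prod.snd) ≫ triProj r s =
        ((e ≫ dirFst (tensor p r) (tensor q s)) ≫ prod.snd) ≫ r.map := by
  have hproj : prod.lift ((c ≫ prod.fst) ≫ triProj p q) ((c ≫ prod.snd) ≫ triProj r s) =
      (e ≫ dirFst (tensor p r) (tensor q s)) ≫ prod.map p.map r.map := by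
    rw [← comp_interchange_pos_proj, h, dir_proj]
  rw [comp_prodMap] at hproj
  exact ⟨by simpa [prod.lift_fst] using hproj =≫ prod.fst,
    by simpa [prod.lift_snd] using hproj =≫ prod.snd⟩

theorem interchange_dir_eval
    (h : c ≫ Hom.pos (interchange p q r s) = e ≫ triHom (tensor p r) (tensor q s)) :
    eval (c ≫ prod.fst) ((e ≫ dirFst (tensor p r) (tensor q s)) ≫ prod.fst)
        (interchange_dir_proj h).1 =
        ((e ≫ dirSnd (tensor p r) (tensor q s)) ≫ prod.fst) ≫ q.map ∧
      eval (c ≫ prod.snd) ((e ≫ dirFst (tensor p r) (tensor q s)) ≫ prod.snd)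
        (interchange_dir_proj h).2 =
        ((e ≫ dirSnd (tensor p r) (tensor q s)) ≫ prod.snd) ≫ s.map := by
  have heval := (eval_comp_interchange_pos c _ (by rw [h, dir_proj])).symm.trans
    ((eval_congr (p := tensor p r) (q := tensor q s) h rfl _).trans (dir_eval e))
  exact ⟨by simpa [tensor, prod.lift_fst] using heval =≫ prod.fst,
    by simpa [tensor, prod.lift_snd] using heval =≫ prod.snd⟩

theorem interchange_app
    (h : c ≫ Hom.pos (interchange p q r s) = e ≫ triHom (tensor p r) (tensor q s)) :
    Hom.app (interchange p q r s) c e h = prod.lift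
      (mkDir (c ≫ prod.fst) ((e ≫ dirFst (tensor p r) (tensor q s)) ≫ prod.fst)
        (interchange_dir_proj h).1 ((e ≫ dirSnd (tensor p r) (tensor q s)) ≫ prod.fst)
        (interchange_dir_eval h).1)
      (mkDir (c ≫ prod.snd) ((e ≫ dirFst (tensor p r) (tensor q s)) ≫ prod.snd)
        (interchange_dir_proj h).2 ((e ≫ dirSnd (tensor p r) (tensor q s)) ≫ prod.snd)
        (interchange_dir_eval h).2) := by
  simp [interchange, Hom.app_mk, prod.comp_lift, comp_mkDir, pullback.lift_fst_assoc,
    pullback.lift_snd_assoc]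

end

theorem comp_triAssoc_hom_pos_proj (c : Y ⟶ triBase (tri p q) r) :
    (c ≫ Hom.pos (triAssoc p q r).hom) ≫ triProj p (tri q r) =
      (c ≫ triProj (tri p q) r) ≫ triProj p q := by
  rw [Category.assoc, Category.assoc]
  exact congrArg (c ≫ ·) assocPos_proj

theorem eval_comp_triAssoc_hom_pos_proj (c : Y ⟶ triBase (tri p q) r) (a : Y ⟶ p.total)
    (h : (c ≫ Hom.pos (triAssoc p q r).hom) ≫ triProj p (tri q r) = a ≫ p.map) :
    eval (q := tri q r) (c ≫ Hom.pos (triAssoc p q r).hom) a h ≫ triProj q r =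
      eval (c ≫ triProj (tri p q) r) a (by rw [← h, comp_triAssoc_hom_pos_proj]) :=
  eval_assocPos_proj c a h

theorem eval_eval_comp_triAssoc_hom_pos (c : Y ⟶ triBase (tri p q) r) (a : Y ⟶ p.total)
    (h : (c ≫ Hom.pos (triAssoc p q r).hom) ≫ triProj p (tri q r) = a ≫ p.map) (d : Y ⟶ q.total)
    (h' : eval (q := tri q r) (c ≫ Hom.pos (triAssoc p q r).hom) a h ≫ triProj q r =
      d ≫ q.map) :
    eval (eval (q := tri q r) (c ≫ Hom.pos (triAssoc p q r).hom) a h) d h' =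
      eval (p := tri p q) c
        (mkDir (c ≫ triProj (tri p q) r) a (by rw [← h, comp_triAssoc_hom_pos_proj]) d
          (by rw [← h', eval_comp_triAssoc_hom_pos_proj]))
        (mkDir_hom _ _ _ _ _).symm :=
  eval_eval_assocPos c a h d h'

section

variable {c : Y ⟶ triBase (tri p q) r} {e : Y ⟶ triTotal p (tri q r)}

theorem triAssoc_dir_proj
    (h : c ≫ Hom.pos (triAssoc p q r).hom = e ≫ triHom p (tri q r)) :
    (c ≫ triProj (tri p q) r) ≫ triProj p q = (e ≫ dirFst p (tri q r)) ≫ p.map := by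
  rw [← comp_triAssoc_hom_pos_proj, h, dir_proj]

theorem eval_comp_triAssoc_hom_pos_dirFst
    (h : c ≫ Hom.pos (triAssoc p q r).hom = e ≫ triHom p (tri q r)) :
    eval (q := tri q r) (c ≫ Hom.pos (triAssoc p q r).hom) (e ≫ dirFst p (tri q r))
      (by rw [h, dir_proj]) = (e ≫ dirSnd p (tri q r)) ≫ triHom q r :=
  (eval_congr (q := tri q r) h rfl _).trans (dir_eval (q := tri q r) e)

theorem triAssoc_dir_eval
    (h : c ≫ Hom.pos (triAssoc p q r).hom = e ≫ triHom p (tri q r)) :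
    eval (c ≫ triProj (tri p q) r) (e ≫ dirFst p (tri q r)) (triAssoc_dir_proj h) =
      ((e ≫ dirSnd p (tri q r)) ≫ dirFst q r) ≫ q.map := by
  rw [← eval_comp_triAssoc_hom_pos_proj c _ (by rw [h, dir_proj]),
    eval_comp_triAssoc_hom_pos_dirFst h, dir_proj]

theorem triAssoc_dir_eval_mkDir
    (h : c ≫ Hom.pos (triAssoc p q r).hom = e ≫ triHom p (tri q r)) :
    eval (p := tri p q) c (mkDir (c ≫ triProj (tri p q) r) (e ≫ dirFst p (tri q r))
      (triAssoc_dir_proj h) ((e ≫ dirSnd p (tri q r)) ≫ dirFst q r)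
      (triAssoc_dir_eval h)) (mkDir_hom _ _ _ _ _).symm =
      ((e ≫ dirSnd p (tri q r)) ≫ dirSnd q r) ≫ r.map := by
  have heval := eval_comp_triAssoc_hom_pos_dirFst h
  refine (eval_eval_comp_triAssoc_hom_pos c _ (by rw [h, dir_proj]) _ ?_).symm.trans
    ((eval_congr heval rfl _).trans (dir_eval _))
  rw [heval, dir_proj]

theorem triAssoc_hom_app
    (h : c ≫ Hom.pos (triAssoc p q r).hom = e ≫ triHom p (tri q r)) :
    Hom.app (triAssoc p q r).hom c e h =
      mkDir (p := tri p q) c (mkDir (c ≫ triProj (tri p q) r) (e ≫ dirFst p (tri q r))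
        (triAssoc_dir_proj h) ((e ≫ dirSnd p (tri q r)) ≫ dirFst q r)
        (triAssoc_dir_eval h)) (mkDir_hom _ _ _ _ _).symm
        ((e ≫ dirSnd p (tri q r)) ≫ dirSnd q r) (triAssoc_dir_eval_mkDir h) := by
  have happ : Hom.app (triAssoc p q r).hom c e h = e ≫ assocDirInv p q r :=
    isoOfArrowIso_hom_app _ _ _ _ _ _
  have hhom : (e ≫ assocDirInv p q r) ≫ triHom (tri p q) r = c :=
    (congrArg (· ≫ _) happ).symm.trans (Hom.app_map _ _ _ _)
  rw [happ]
  refine dir_ext (p := tri p q) ?_ ?_ ?_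
  · rw [hhom, mkDir_hom]
  · rw [mkDir_fst]
    apply dir_ext
    · rw [← dir_proj (p := tri p q), hhom, mkDir_hom]
    · simpa using congrArg (e ≫ ·) (assocDirInv_fst_fst p q r)
    · simpa using congrArg (e ≫ ·) (assocDirInv_fst_snd p q r)
  · simpa using congrArg (e ≫ ·) (assocDirInv_snd p q r)

end

theorem comp_triLeftUnitor_hom_pos (c : Y ⟶ triBase y p) :
    c ≫ Hom.pos (triLeftUnitor p).hom =
      eval (p := y) (q := p) c (terminal.from Y) (terminal.hom_ext _ _) :=
  comp_triLeftBase p c _ _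

theorem triLeftUnitor_hom_app (c : Y ⟶ triBase y p) (d : Y ⟶ p.total)
    (h : c ≫ Hom.pos (triLeftUnitor p).hom = d ≫ p.map) :
    Hom.app (triLeftUnitor p).hom c d h = mkDir (p := y) (q := p) c (terminal.from Y)
      (terminal.hom_ext _ _) d ((comp_triLeftUnitor_hom_pos c).symm.trans h) := by
  refine dir_ext (p := y) ?_ (terminal.hom_ext _ _) ?_
  · rw [mkDir_hom]
    exact Hom.app_map _ _ _ _
  · rw [mkDir_snd]
    exact (congrArg (· ≫ dirSnd y p) (isoOfArrowIso_hom_app _ _ _ _ _ _)).trans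
      ((Category.assoc _ _ _).trans
        ((congrArg (d ≫ ·) (triLeftTotalIso p).inv_hom_id).trans (Category.comp_id d)))

theorem comp_triRightUnitor_hom_pos (c : Y ⟶ triBase p y) :
    c ≫ Hom.pos (triRightUnitor p).hom = c ≫ triProj p y := rfl

theorem triRightUnitor_hom_app (c : Y ⟶ triBase p y) (d : Y ⟶ p.total)
    (h : c ≫ Hom.pos (triRightUnitor p).hom = d ≫ p.map) :
    Hom.app (triRightUnitor p).hom c d h = mkDir (q := y) c d
      ((comp_triRightUnitor_hom_pos c).symm.trans h) (terminal.from Y) (terminal.hom_ext _ _) := by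
  refine dir_ext (q := y) ?_ ?_ (terminal.hom_ext _ _)
  · rw [mkDir_hom]
    exact Hom.app_map _ _ _ _
  · rw [mkDir_fst]
    exact (congrArg (· ≫ dirFst p y) (isoOfArrowIso_hom_app _ _ _ _ _ _)).trans
      ((Category.assoc _ _ _).trans
        ((congrArg (d ≫ ·) (triRightTotalIso p).inv_hom_id).trans (Category.comp_id d)))

theorem tensorAssoc_hom_pos :
    Hom.pos (tensorAssoc p q r).hom = (prod.associator p.base q.base r.base).hom := rfl

theorem tensorAssoc_hom_app (b : Y ⟶ (p.base ⨯ q.base) ⨯ r.base)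
    (d : Y ⟶ p.total ⨯ q.total ⨯ r.total)
    (h : b ≫ Hom.pos (tensorAssoc p q r).hom = d ≫ prod.map p.map (prod.map q.map r.map)) :
    Hom.app (tensorAssoc p q r).hom b d h = prod.lift
      (prod.lift (d ≫ prod.fst) ((d ≫ prod.snd) ≫ prod.fst)) ((d ≫ prod.snd) ≫ prod.snd) :=
  (isoOfArrowIso_hom_app _ _ _ _ _ _).trans (comp_prodAssociator_inv d)

theorem tensorLeftUnitor_hom_pos : Hom.pos (tensorLeftUnitor p).hom = prod.snd := rfl

theorem tensorLeftUnitor_hom_app (b : Y ⟶ (⊤_ E) ⨯ p.base) (d : Y ⟶ p.total)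
    (h : b ≫ Hom.pos (tensorLeftUnitor p).hom = d ≫ p.map) :
    Hom.app (tensorLeftUnitor p).hom b d h = prod.lift (terminal.from _) d := by
  refine (isoOfArrowIso_hom_app _ _ _ _ _ _).trans ?_
  simp [prod.comp_lift]

theorem tensorRightUnitor_hom_pos : Hom.pos (tensorRightUnitor p).hom = prod.fst := rfl

theorem tensorRightUnitor_hom_app (b : Y ⟶ p.base ⨯ (⊤_ E)) (d : Y ⟶ p.total)
    (h : b ≫ Hom.pos (tensorRightUnitor p).hom = d ≫ p.map) :
    Hom.app (tensorRightUnitor p).hom b d h = prod.lift d (terminal.from _) := by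
  refine (isoOfArrowIso_hom_app _ _ _ _ _ _).trans ?_
  simp [prod.comp_lift]

theorem hom_y_ext [Mono p.map] (φ ψ : p ⟶ y) : φ = ψ :=
  Hom.ext_of_mono (terminal.hom_ext _ _)

instance mono_map_y : Mono (y : PolyCat E).map := inferInstanceAs (Mono (𝟙 _))

theorem hom_tri_ext {φ ψ : s ⟶ tri p q}
    (hproj : ∀ ⦃Y : E⦄ (b : Y ⟶ s.base),
      (b ≫ Hom.pos φ) ≫ triProj p q = (b ≫ Hom.pos ψ) ≫ triProj p q)
    (heval : ∀ ⦃Y : E⦄ (b : Y ⟶ s.base) (a : Y ⟶ p.total)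
      (hφ : (b ≫ Hom.pos φ) ≫ triProj p q = a ≫ p.map)
      (hψ : (b ≫ Hom.pos ψ) ≫ triProj p q = a ≫ p.map),
      eval (b ≫ Hom.pos φ) a hφ = eval (b ≫ Hom.pos ψ) a hψ)
    (happ : ∀ ⦃Y : E⦄ (b : Y ⟶ s.base) (e : Y ⟶ triTotal p q)
      (hφ : b ≫ Hom.pos φ = e ≫ triHom p q) (hψ : b ≫ Hom.pos ψ = e ≫ triHom p q),
      Hom.app φ b e hφ = Hom.app ψ b e hψ) : φ = ψ :=
  Hom.ext_app (pos_ext (by simpa using hproj (𝟙 _)) fun _ b => heval b) happ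

theorem hom_tri_tri_ext {φ ψ : s ⟶ tri p (tri q r)}
    (hproj : ∀ ⦃Y : E⦄ (b : Y ⟶ s.base),
      (b ≫ Hom.pos φ) ≫ triProj p (tri q r) = (b ≫ Hom.pos ψ) ≫ triProj p (tri q r))
    (heval : ∀ ⦃Y : E⦄ (b : Y ⟶ s.base) (a : Y ⟶ p.total)
      (hφ : (b ≫ Hom.pos φ) ≫ triProj p (tri q r) = a ≫ p.map)
      (hψ : (b ≫ Hom.pos ψ) ≫ triProj p (tri q r) = a ≫ p.map),
      eval (q := tri q r) (b ≫ Hom.pos φ) a hφ ≫ triProj q r =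
        eval (q := tri q r) (b ≫ Hom.pos ψ) a hψ ≫ triProj q r)
    (heval' : ∀ ⦃Y : E⦄ (b : Y ⟶ s.base) (a : Y ⟶ p.total)
      (hφ : (b ≫ Hom.pos φ) ≫ triProj p (tri q r) = a ≫ p.map)
      (hψ : (b ≫ Hom.pos ψ) ≫ triProj p (tri q r) = a ≫ p.map) (d : Y ⟶ q.total)
      (hφ' : eval (q := tri q r) (b ≫ Hom.pos φ) a hφ ≫ triProj q r = d ≫ q.map)
      (hψ' : eval (q := tri q r) (b ≫ Hom.pos ψ) a hψ ≫ triProj q r = d ≫ q.map),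
      eval (eval (q := tri q r) (b ≫ Hom.pos φ) a hφ) d hφ' =
        eval (eval (q := tri q r) (b ≫ Hom.pos ψ) a hψ) d hψ')
    (happ : ∀ ⦃Y : E⦄ (b : Y ⟶ s.base) (e : Y ⟶ triTotal p (tri q r))
      (hφ : b ≫ Hom.pos φ = e ≫ triHom p (tri q r))
      (hψ : b ≫ Hom.pos ψ = e ≫ triHom p (tri q r)),
      Hom.app φ b e hφ = Hom.app ψ b e hψ) : φ = ψ := by
  refine hom_tri_ext hproj (fun Y b a hφ hψ => pos_ext (heval b a hφ hψ) ?_) happ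
  intro Z x d hφ' hψ'
  simp only [comp_eval, ← Category.assoc] at hφ' hψ' ⊢
  exact heval' _ _ _ _ _ hφ' hψ'

theorem app_y {φ : y ⟶ p} (b : Y ⟶ ⊤_ E) (d : Y ⟶ p.total) (h : b ≫ Hom.pos φ = d ≫ p.map) :
    Hom.app φ b d h = terminal.from Y := terminal.hom_ext _ _

theorem comp_dirFst_y (e : Y ⟶ triTotal y p) : e ≫ dirFst y p = terminal.from Y :=
  terminal.hom_ext _ _

theorem comp_dirSnd_y (e : Y ⟶ triTotal p y) : e ≫ dirSnd p y = terminal.from Y :=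
  terminal.hom_ext _ _

theorem comp_triProj_y (c : Y ⟶ triBase y p) : c ≫ triProj y p = terminal.from Y :=
  terminal.hom_ext _ _

theorem eval_y (c : Y ⟶ triBase p y) (a : Y ⟶ p.total) (h : c ≫ triProj p y = a ≫ p.map) :
    eval (q := y) c a h = terminal.from Y := terminal.hom_ext _ _

theorem mkDir_of_eq_comp_triHom {c : Y ⟶ triBase p q} {e : Y ⟶ triTotal p q}
    (h : c = e ≫ triHom p q) :
    mkDir c (e ≫ dirFst p q) (by rw [h, dir_proj]) (e ≫ dirSnd p q) (by subst h; exact dir_eval e) =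
      e := by
  subst h
  apply dir_ext <;> simp

section

-- Everything is normalized to the shape `x ≫ f` of an element `x` acted on by `f`, so composites
-- are associated to the left: hence `← Category.assoc` below.
attribute [local simp] comp_prodMap prodLift_comp_fst_comp_snd
  prod.lift_fst prod.lift_snd prod.comp_lift
  id_app comp_app Hom.comp_app comp_eval comp_mkDir
  tensorMap_pos tensorMap_app tensorAssoc_hom_pos tensorAssoc_hom_app
  tensorLeftUnitor_hom_pos tensorLeftUnitor_hom_app
  tensorRightUnitor_hom_pos tensorRightUnitor_hom_app
  comp_triMap_pos_proj eval_comp_triMap_pos triMap_app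
  comp_triAssoc_hom_pos_proj eval_comp_triAssoc_hom_pos_proj eval_eval_comp_triAssoc_hom_pos
  triAssoc_hom_app comp_triLeftUnitor_hom_pos triLeftUnitor_hom_app
  comp_triRightUnitor_hom_pos triRightUnitor_hom_app
  comp_interchange_pos_proj eval_comp_interchange_pos interchange_app
  app_y comp_dirFst_y comp_dirSnd_y comp_triProj_y eval_y

theorem tensorMap_id : tensorMap (𝟙 p) (𝟙 q) = 𝟙 (tensor p q) := by
  apply hom_ext_elements <;> simp

theorem tensorMap_comp {p'' q'' : PolyCat E} (φ : p ⟶ p') (ψ : q ⟶ q') (φ' : p' ⟶ p'')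
    (ψ' : q' ⟶ q'') :
    tensorMap (φ ≫ φ') (ψ ≫ ψ') = tensorMap φ ψ ≫ tensorMap φ' ψ' := by
  apply hom_ext_elements <;> simp [← Category.assoc]

theorem tensorAssoc_naturality (φ : p ⟶ p') (ψ : q ⟶ q') (χ : r ⟶ r') :
    tensorMap (tensorMap φ ψ) χ ≫ (tensorAssoc p' q' r').hom =
      (tensorAssoc p q r).hom ≫ tensorMap φ (tensorMap ψ χ) := by
  apply hom_ext_elements <;> simp [← Category.assoc]

theorem tensorLeftUnitor_naturality (φ : p ⟶ p') :
    tensorMap (𝟙 y) φ ≫ (tensorLeftUnitor p').hom = (tensorLeftUnitor p).hom ≫ φ := by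
  apply hom_ext_elements <;> simp [← Category.assoc]

theorem tensorRightUnitor_naturality (φ : p ⟶ p') :
    tensorMap φ (𝟙 y) ≫ (tensorRightUnitor p').hom = (tensorRightUnitor p).hom ≫ φ := by
  apply hom_ext_elements <;> simp [← Category.assoc]

theorem tensor_pentagon :
    tensorMap (tensorAssoc p q r).hom (𝟙 s) ≫ (tensorAssoc p (tensor q r) s).hom ≫
        tensorMap (𝟙 p) (tensorAssoc q r s).hom =
      (tensorAssoc (tensor p q) r s).hom ≫ (tensorAssoc p q (tensor r s)).hom := by
  apply hom_ext_elements <;> simp [← Category.assoc]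

theorem tensor_triangle :
    (tensorAssoc p y q).hom ≫ tensorMap (𝟙 p) (tensorLeftUnitor q).hom =
      tensorMap (tensorRightUnitor p).hom (𝟙 q) := by
  apply hom_ext_elements <;> simp [← Category.assoc]

theorem isMonoidal_tensorStruct : IsMonoidal (tensorStruct E) := by
  let := tensorStruct E
  exact ⟨.ofTensorHom (id_tensorHom_id := fun _ _ => tensorMap_id)
    (tensorHom_comp_tensorHom := fun _ _ _ _ => (tensorMap_comp _ _ _ _).symm)
    (associator_naturality := tensorAssoc_naturality)
    (leftUnitor_naturality := tensorLeftUnitor_naturality)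
    (rightUnitor_naturality := tensorRightUnitor_naturality)
    (pentagon := fun _ _ _ _ => tensor_pentagon)
    (triangle := fun _ _ => tensor_triangle), rfl⟩

theorem triMap_id : triMap (𝟙 p) (𝟙 q) = 𝟙 (tri p q) := by
  apply hom_tri_ext <;> simp +contextual [-Category.assoc, mkDir_of_eq_comp_triHom]

theorem triMap_comp {p'' q'' : PolyCat E} (φ : p ⟶ p') (ψ : q ⟶ q') (φ' : p' ⟶ p'')
    (ψ' : q' ⟶ q'') :
    triMap (φ ≫ φ') (ψ ≫ ψ') = triMap φ ψ ≫ triMap φ' ψ' := by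
  apply hom_tri_ext <;> simp [← Category.assoc]

theorem triAssoc_naturality (φ : p ⟶ p') (ψ : q ⟶ q') (χ : r ⟶ r') :
    triMap (triMap φ ψ) χ ≫ (triAssoc p' q' r').hom =
      (triAssoc p q r).hom ≫ triMap φ (triMap ψ χ) := by
  apply hom_tri_tri_ext <;> simp [← Category.assoc]

theorem triLeftUnitor_naturality (φ : p ⟶ p') :
    triMap (𝟙 y) φ ≫ (triLeftUnitor p').hom = (triLeftUnitor p).hom ≫ φ := by
  apply hom_ext_elements <;> simp [← Category.assoc]

theorem triRightUnitor_naturality (φ : p ⟶ p') :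
    triMap φ (𝟙 y) ≫ (triRightUnitor p').hom = (triRightUnitor p).hom ≫ φ := by
  apply hom_ext_elements <;> simp [← Category.assoc]

theorem tri_pentagon :
    triMap (triAssoc p q r).hom (𝟙 s) ≫ (triAssoc p (tri q r) s).hom ≫
        triMap (𝟙 p) (triAssoc q r s).hom =
      (triAssoc (tri p q) r s).hom ≫ (triAssoc p q (tri r s)).hom := by
  refine hom_tri_tri_ext (r := tri r s) ?_ ?_ (fun Y c a h h' d k k' => pos_ext ?_ ?_) ?_ <;>
    simp [← Category.assoc]

theorem tri_triangle :
    (triAssoc p y q).hom ≫ triMap (𝟙 p) (triLeftUnitor q).hom =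
      triMap (triRightUnitor p).hom (𝟙 q) := by
  apply hom_tri_ext <;> simp [← Category.assoc]

theorem isMonoidal_triStruct : IsMonoidal (triStruct E) := by
  let := triStruct E
  exact ⟨.ofTensorHom (id_tensorHom_id := fun _ _ => triMap_id)
    (tensorHom_comp_tensorHom := fun _ _ _ _ => (triMap_comp _ _ _ _).symm)
    (associator_naturality := triAssoc_naturality)
    (leftUnitor_naturality := triLeftUnitor_naturality)
    (rightUnitor_naturality := triRightUnitor_naturality)
    (pentagon := fun _ _ _ _ => tri_pentagon)
    (triangle := fun _ _ => tri_triangle), rfl⟩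

theorem interchange_naturality (φ : p ⟶ p') (ψ : q ⟶ q') (χ : r ⟶ r') (ω : s ⟶ s') :
    tensorMap (triMap φ ψ) (triMap χ ω) ≫ interchange p' q' r' s' =
      interchange p q r s ≫ triMap (tensorMap φ χ) (tensorMap ψ ω) := by
  apply hom_tri_ext (p := tensor p' r') (q := tensor q' s') <;> simp [← Category.assoc]

theorem interchange_tensorAssoc :
    tensorMap (interchange p q r s) (𝟙 (tri t w)) ≫
        interchange (tensor p r) (tensor q s) t w ≫
        triMap (tensorAssoc p r t).hom (tensorAssoc q s w).hom =
      (tensorAssoc (tri p q) (tri r s) (tri t w)).hom ≫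
        tensorMap (𝟙 (tri p q)) (interchange r s t w) ≫
        interchange p q (tensor r t) (tensor s w) := by
  apply hom_tri_ext (p := tensor p (tensor r t)) (q := tensor q (tensor s w)) <;>
    simp [← Category.assoc]

theorem interchange_triAssoc :
    interchange (tri p q) r (tri s t) w ≫ triMap (interchange p q s t) (𝟙 (tensor r w)) ≫
        (triAssoc (tensor p s) (tensor q t) (tensor r w)).hom =
      tensorMap (triAssoc p q r).hom (triAssoc s t w).hom ≫
        interchange p (tri q r) s (tri t w) ≫
        triMap (𝟙 (tensor p s)) (interchange q r t w) := by
  apply hom_tri_tri_ext (p := tensor p s) (q := tensor q t) (r := tensor r w) <;>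
    simp [← Category.assoc]

theorem interchange_tensorLeftUnitor :
    tensorMap (triLeftUnitor y).inv (𝟙 (tri p q)) ≫ interchange y y p q ≫
        triMap (tensorLeftUnitor p).hom (tensorLeftUnitor q).hom =
      (tensorLeftUnitor (tri p q)).hom := by
  refine hom_tri_ext ?_ ?_ fun Y b e h h' => ?_
  · simp [← Category.assoc]
  · simp [← Category.assoc]
  · refine Eq.trans ?_ (tensorLeftUnitor_hom_app b e h').symm
    replace h' : b ≫ prod.snd = e ≫ triHom p q := h'
    simp [← Category.assoc, mkDir_of_eq_comp_triHom h']

theorem interchange_tensorRightUnitor :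
    tensorMap (𝟙 (tri p q)) (triLeftUnitor y).inv ≫ interchange p q y y ≫
        triMap (tensorRightUnitor p).hom (tensorRightUnitor q).hom =
      (tensorRightUnitor (tri p q)).hom := by
  refine hom_tri_ext ?_ ?_ fun Y b e h h' => ?_
  · simp [← Category.assoc]
  · simp [← Category.assoc]
  · refine Eq.trans ?_ (tensorRightUnitor_hom_app b e h').symm
    replace h' : b ≫ prod.fst = e ≫ triHom p q := h'
    simp [← Category.assoc, mkDir_of_eq_comp_triHom h']

theorem interchange_triLeftUnitor :
    interchange y p y q ≫ triMap (tensorLeftUnitor y).hom (𝟙 (tensor p q)) ≫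
        (triLeftUnitor (tensor p q)).hom =
      tensorMap (triLeftUnitor p).hom (triLeftUnitor q).hom := by
  apply hom_ext_elements <;> simp [← Category.assoc]

theorem interchange_triRightUnitor :
    interchange p y q y ≫ triMap (𝟙 (tensor p q)) (tensorLeftUnitor y).hom ≫
        (triRightUnitor (tensor p q)).hom =
      tensorMap (triRightUnitor p).hom (triRightUnitor q).hom := by
  apply hom_ext_elements <;> simp [← Category.assoc]

end

theorem isDuoidal_duoidalStruct : (duoidalStruct E).IsDuoidal where
  monoidal_M := isMonoidal_tensorStruct
  monoidal_N := isMonoidal_triStruct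
  interchange_natural := interchange_naturality
  interchange_assoc_M _ _ _ _ _ _ := interchange_tensorAssoc
  interchange_assoc_N _ _ _ _ _ _ := interchange_triAssoc
  left_unit_M _ _ := interchange_tensorLeftUnitor
  right_unit_M _ _ := interchange_tensorRightUnitor
  left_unit_N _ _ := interchange_triLeftUnitor
  right_unit_N _ _ := interchange_triRightUnitor
  unit_mult := hom_y_ext (p := tensor y y) _ _
  mult_unit := hom_y_ext (p := tensor y y) _ _
  mult_assoc := hom_y_ext (p := tensor (tensor y y) y) _ _
  unit_comult := hom_y_ext _ _
  comult_unit := hom_y_ext _ _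
  comult_assoc :=
    (cancel_mono ((triLeftUnitor (tri y y)).hom ≫ (triLeftUnitor y).hom)).1 (hom_y_ext _ _)

end

end PolyCat

theorem mainTheorem5 {E : Type u} [Category.{v} E] [HasFiniteLimits E] :
    IsMonoidal (PolyCat.tensorStruct E) ∧ (PolyCat.duoidalStruct E).IsNormalDuoidal :=
  ⟨PolyCat.isMonoidal_tensorStruct, PolyCat.isDuoidal_duoidalStruct,
    inferInstanceAs (IsIso (𝟙 (PolyCat.y : PolyCat E)))⟩
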